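/- **Definitions.** An infinite real matrix is *totally positive* (TP) if all its minors are nonnegative; a matrix over a polynomial ring $\mathbb R[\mathbf x]$ is $\mathbf x$-TP if all its minors are polynomials with nonnegative coefficients. A formal power series $\sum_n a_nt^n\in\mathbb R[[t]]$ is *PF* if its Toeplitz matrix $[a_{i-j}]_{i,j\ge0}$ (with $a_n=0$ for $n<0$) is TP. A real sequence $(a_n)_{n\ge0}$ is *Stieltjes moment* (SM) if $a_n=\int_0^\infty x^n\,d\mu(x)$ for all $n\ge 0$ for some nonnegative measure $\mu$ on $[0,\infty)$; a sequence in $\mathbb R[\mathbf x]$ is $\mathbf x$-SM if its Hankel matrix $[a_{i+j}]_{i,j\ge0}$ is $\mathbf x$-TP. With $\mathcal L[a_i]=a_{i-1}a_{i+1}-a_i^2$ $(i\ge1)$, a sequence is *$3$-$\mathbf x$-log-convex* if all terms $\mathcal L^m[a_i]$ $(i\ge m)$, $0\le m\le 3$, have nonnegative coefficients (*$3$-log-convex*, for a real sequence, if they are nonnegative). For a lower triangular real matrix $A=[a_{n,k}]$, the *$A$-convolution* $z_n=\sum_{k=0}^n a_{n,k}x_ky_{n-k}$ *preserves the SM property*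 if $(z_n)$ is SM whenever $(x_n)$ and $(y_n)$ are. Let $f(t)=\sum_{n\ge1}f_n\frac{t^n}{n!}\in\mathbb R[[t]]$ with $f_1\ne0$, and let $\bar f$ be its compositional inverse. For a series $g$ with $g(0)=1$ and $h\in\{f,\bar f\}$ define $S_{n,k}(h,g)$, $L_{n,k}(h)$, $\widetilde L_{n,k}(h)$ by $$g(t)e^{q h(t)}=\sum_{n\ge0}\Big(\sum_{k=0}^nS_{n,k}(h,g)q^k\Big)\frac{t^n}{n!},\qquad \log(1-q h(t))=-\sum_{n\ge1}\Big(\sum_{k=1}^nL_{n,k}(h)q^k\Big)\frac{t^n}{n!},\qquad \frac1{1-q h(t)}=\sum_{n\ge0}\Big(\sum_{k=0}^n\widetilde L_{n,k}(h)q^k\Big)\frac{t^n}{n!},$$ with the conventions $L_{0,0}(h)=1$ and $L_{n,0}(h)=L_{0,n}(h)=0$ for $n\ge1$. Put $S_n(f,g;q)=\sum_{k=0}^nS_{n,k}(f,g)q^k$ and $S_n^*(f,g;q)=q^nS_n(f,g;1/q)$. **Theorem.** Let $g(t)=\exp(\lambda f(t))$. Suppose that $1/\bar f'(t)$ is PF.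 Then: (i) with $\lambda,q$ indeterminates, both $(S_n(f,g;q))_{n\ge0}$ and $(S_n^*(f,g;q))_{n\ge0}$ are $(\lambda,q)$-SM and $3$-$(\lambda,q)$-log-convex; (ii) $(f_{n+1})_{n\ge0}$ is SM and $3$-log-convex; (iii) with $\lambda$ an indeterminate, $[S_{n,k}(f,g)]_{n,k\ge0}$ is $\lambda$-TP; (iv) the matrices $[L_{n,k}(f)]$, $[\widetilde L_{n,k}(f)]$, $[(-1)^{n-k}S_{n,k}(\bar f,1)]$, $[(-1)^{n-k}L_{n,k}(\bar f)]$ and $[(-1)^{n-k}\widetilde L_{n,k}(\bar f)]$ $(n,k\ge0)$ are TP; (v) the $A$-convolution preserves the SM property if $A$ is any of $[S_{n,k}(f,g)]_{n,k\ge0}$ with $\lambda\ge0$ real, $[S_{n+1,k+1}(f,1)]_{n,k\ge0}$, and $[\widetilde L_{n,k}(f)]_{n,k\ge0}$; (vi) if $1/\bar f'(t)=\prod_{i=1}^m(1+x_it)$ with $x_1,\dots,x_m\in\mathbb R$, then, with $\lambda,q$ indeterminates, $$\sum_{n\ge0}S_n(f,g;q)t^n=\cfrac{1}{1-\alpha_mt\prod\limits_{i_1=1}^m\cfrac{1}{1-\alpha_{m+i_1}t\prod\limits_{i_2=1}^m\cfrac{1}{1-\alpha_{m+i_1+i_2}t\prod\limits_{i_3=1}^m\cfrac1{1-\cdots}}}}$$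 and the same identity holds for $\sum_{n\ge0}S_n^*(f,g;q)t^n$ with $\beta$ in place of $\alpha$, where $$(\alpha_i)_{i\ge m}=(\lambda+q,\,x_1,\dots,x_m,\,\lambda+q,\,2x_1,\dots,2x_m,\,\lambda+q,\,3x_1,\dots,3x_m,\dots),$$ $$(\beta_i)_{i\ge m}=(q\lambda+1,\,qx_1,\dots,qx_m,\,q\lambda+1,\,2qx_1,\dots,2qx_m,\,q\lambda+1,\,3qx_1,\dots,3qx_m,\dots).$$ The infinite fraction is understood as the coefficientwise limit of its finite truncations in the ring of formal power series in $t$ over $\mathbb R[\lambda,q]$. -/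

import Mathlib

open PowerSeries

noncomputable section

namespace ShefferTP

/-! ### Total positivity, Pólya frequency, moment sequences

Positivity notions are stated relative to a set of "nonnegative" elements `P : R → Prop`:
nonnegative reals in `ℝ`, or polynomials with nonnegative coefficients in `ℝ[λ]` or `ℝ[λ][q]`. -/

/-- All minors (of all orders) of the infinite matrix `M` satisfy `P`. -/
def MinorsSatisfy {R : Type*} [CommRing R] (P : R → Prop) (M : ℕ → ℕ → R) : Prop :=
  ∀ (k : ℕ) (r c : Fin k → ℕ), StrictMono r → StrictMono c →
    P (Matrix.det (Matrix.of fun i j : Fin k => M (r i) (c j)))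

/-- A univariate real polynomial with nonnegative coefficients. -/
def NonnegCoeff (p : Polynomial ℝ) : Prop := ∀ i, 0 ≤ p.coeff i

/-- A real polynomial in two indeterminates, regarded as an element of `ℝ[λ][q]`,
with nonnegative coefficients. -/
def NonnegCoeff₂ (p : Polynomial (Polynomial ℝ)) : Prop := ∀ i j, 0 ≤ (p.coeff i).coeff j

/-- A real matrix is totally positive (TP). -/
def IsTP (M : ℕ → ℕ → ℝ) : Prop := MinorsSatisfy (fun x : ℝ => 0 ≤ x) M

/-- A matrix over `ℝ[λ]` is `λ`-totally positive. -/
def IsPolyTP (M : ℕ → ℕ → Polynomial ℝ) : Prop := MinorsSatisfy NonnegCoeff M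

/-- A sequence in `ℝ[λ, q]` is `(λ, q)`-Stieltjes moment: its Hankel matrix is `(λ, q)`-TP. -/
def IsPolySM₂ (a : ℕ → Polynomial (Polynomial ℝ)) : Prop :=
  MinorsSatisfy NonnegCoeff₂ fun i j => a (i + j)

/-- A formal power series is PF: the Toeplitz matrix `[a_{i-j}]` of its coefficients is TP. -/
def IsPF (φ : ℝ⟦X⟧) : Prop :=
  IsTP fun i j => if j ≤ i then coeff (i - j) φ else 0

/-- A real sequence is Stieltjes moment: `a k = ∫_{[0,∞)} x ^ k dμ(x)` for all `k`, for some
nonnegative measure `μ` on `[0, ∞)` (with finite moments). -/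
def IsSM (a : ℕ → ℝ) : Prop :=
  ∃ μ : MeasureTheory.Measure ℝ, μ (Set.Iio 0) = 0 ∧
    ∀ k : ℕ, MeasureTheory.Integrable (fun x : ℝ => x ^ k) μ ∧ a k = ∫ x, x ^ k ∂μ

/-- The operator `𝓛[a_i] = a_{i-1} a_{i+1} - a_i ^ 2` for `i ≥ 1`; the output is re-indexed to
start at `0`, so that its `i`-th term is `𝓛[a_{i+1}]` and the `i`-th term of the `m`-th iterate
is `𝓛^m[a_{i+m}]`. -/
def logConvexOp {R : Type*} [CommRing R] (a : ℕ → R) : ℕ → R :=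
  fun i => a i * a (i + 2) - a (i + 1) ^ 2

/-- `k`-log-convexity relative to `P`: all terms of `𝓛^m[a]` satisfy `P`, for all `m ≤ k`. -/
def IsLogConvexOfOrder {R : Type*} [CommRing R] (P : R → Prop) (k : ℕ) (a : ℕ → R) : Prop :=
  ∀ m ≤ k, ∀ i, P ((logConvexOp^[m] a) i)

/-- The `A`-convolution `z_n = ∑_{k=0}^n A_{n,k} x_k y_{n-k}` preserves the SM property. -/
def ConvolutionPreservesSM (A : ℕ → ℕ → ℝ) : Prop :=
  ∀ x y : ℕ → ℝ, IsSM x → IsSM y →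
    IsSM fun n => ∑ k ∈ Finset.range (n + 1), A n k * x k * y (n - k)

/-! ### Sheffer, logarithmic and fractional triangles -/

/-- `exp (c * f(t))`, for `f` with zero constant term. -/
def expMul {A : Type*} [CommRing A] [Algebra ℚ A] (c : A) (f : A⟦X⟧) : A⟦X⟧ :=
  (exp A).subst (C c * f)

/-- The Sheffer polynomial `S_n(f, g; q) ∈ A[q]`, given by
`∑ S_n(f, g; q) t^n / n! = g(t) exp (q f(t))`. -/
def shefferPoly {A : Type*} [CommRing A] [Algebra ℚ A] (f g : A⟦X⟧) (n : ℕ) : Polynomial A :=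
  n.factorial • coeff n
    (PowerSeries.map Polynomial.C g *
      expMul (Polynomial.X : Polynomial A) (PowerSeries.map Polynomial.C f))

/-- The Sheffer triangle: `S_{n,k}(f, g)` is the coefficient of `q ^ k` in `S_n(f, g; q)`. -/
def sheffer {A : Type*} [CommRing A] [Algebra ℚ A] (f g : A⟦X⟧) (n k : ℕ) : A :=
  (shefferPoly f g n).coeff k

/-- The power series `q f(t)` over `ℝ[q]`. -/
def qMul (f : ℝ⟦X⟧) : (Polynomial ℝ)⟦X⟧ :=
  C (Polynomial.X : Polynomial ℝ) * PowerSeries.map Polynomial.C f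

/-- The logarithmic polynomial: `log (1 - q f(t)) = - ∑_{n ≥ 1} L_n(f; q) t^n / n!`, and
`L_0(f; q) = 1` by convention. -/
def logPoly (f : ℝ⟦X⟧) (n : ℕ) : Polynomial ℝ :=
  if n = 0 then 1
  else -(n.factorial • coeff n ((PowerSeries.log (Polynomial ℝ)).subst (-qMul f)))

/-- The logarithmic triangle `L_{n,k}(f)`. -/
def logTriangle (f : ℝ⟦X⟧) (n k : ℕ) : ℝ := (logPoly f n).coeff k

/-- The fractional polynomial: `1 / (1 - q f(t)) = ∑ L̃_n(f; q) t^n / n!`. -/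
def fracPoly (f : ℝ⟦X⟧) (n : ℕ) : Polynomial ℝ :=
  n.factorial • coeff n (invOfUnit (1 - qMul f) 1)

/-- The fractional triangle `L̃_{n,k}(f)`. -/
def fracTriangle (f : ℝ⟦X⟧) (n k : ℕ) : ℝ := (fracPoly f n).coeff k

/-- The matrix `[(-1)^{n-k} M_{n,k}]`. -/
def signed (M : ℕ → ℕ → ℝ) (n k : ℕ) : ℝ := (-1) ^ (n + k) * M n k

/-- `f` with its coefficients regarded as constants of `ℝ[λ]`. -/
def liftSeries (f : ℝ⟦X⟧) : (Polynomial ℝ)⟦X⟧ := PowerSeries.map Polynomial.C f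

/-- `g(t) = exp (λ f(t))` with `λ` an indeterminate, the variable of the coefficient ring
`ℝ[λ]`. -/
def expLam (f : ℝ⟦X⟧) : (Polynomial ℝ)⟦X⟧ := expMul Polynomial.X (liftSeries f)

/-- `S_n(f, exp (λ f); q)` with `λ` and `q` indeterminates, as an element of `ℝ[λ][q]`. -/
def shefferExp (f : ℝ⟦X⟧) (n : ℕ) : Polynomial (Polynomial ℝ) :=
  shefferPoly (liftSeries f) (expLam f) n

/-- The reciprocal polynomial `S_n^*(f, exp (λ f); q) = q^n S_n(f, exp (λ f); 1/q)`. -/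
def shefferExpStar (f : ℝ⟦X⟧) (n : ℕ) : Polynomial (Polynomial ℝ) :=
  Polynomial.reflect n (shefferExp f n)

/-- The exponential coefficients `f_n` in `f(t) = ∑ f_n t^n / n!`. -/
def egfCoeff (f : ℝ⟦X⟧) (n : ℕ) : ℝ := n.factorial * coeff n f

/-! ### `m`-branched Stieltjes-type continued fractions -/

/-- Convergents of the `m`-branched Stieltjes-type continued fraction; here `a j` stands for the
coefficient `α_{m+j}`. `branchedConvergent m a N k` is the fraction
`1 / (1 - a_k t ∏_{i=1}^m 1 / (1 - a_{k+i} t ∏_{i'=1}^m 1 / (1 - a_{k+i+i'} t ⋯)))`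
with `N` levels, the first one having the coefficient `a_k`. -/
def branchedConvergent {R : Type*} [CommRing R] (m : ℕ) (a : ℕ → R) : ℕ → ℕ → R⟦X⟧
  | 0, _ => 1
  | N + 1, k =>
      invOfUnit (1 - C (a k) * X * ∏ i : Fin m, branchedConvergent m a N (k + (i + 1))) 1

/-- `F` is the value of the `m`-branched Stieltjes-type continued fraction with coefficients
`α_{m+j} = a j`: the convergents tend to `F` coefficientwise (each coefficient is eventually
constant). -/
def HasBranchedFraction {R : Type*} [CommRing R] (m : ℕ) (a : ℕ → R) (F : R⟦X⟧) : Prop :=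
  ∀ n, ∀ᶠ N in Filter.atTop, coeff n (branchedConvergent m a N 0) = coeff n F

/-- The sequence `c, y_1, …, y_m, c, 2 y_1, …, 2 y_m, c, 3 y_1, …, 3 y_m, …`, indexed from `0`
(`y i` is `y_{i+1}`). -/
def blockSeq {R : Type*} [CommRing R] {m : ℕ} (c : R) (y : Fin m → R) (j : ℕ) : R :=
  if h : j % (m + 1) = 0 then c
  else ((j / (m + 1) + 1 : ℕ) : R) *
    y ⟨j % (m + 1) - 1, by have := Nat.mod_lt j (show m + 1 > 0 by omega); omega⟩

end ShefferTP

end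

/-!
Differentiating `f̄(f(t)) = t` shows `f' = φ(f)` with `φ = 1 / f̄'`. The exponential Riordan array
`S(f, exp (λ f))` is therefore governed by the total positivity of `φ`: deleting its first row
multiplies it on the right by the product of `[j! / k! φ_{j-k}]`, a rescaled Toeplitz matrix of
`φ`, and the bidiagonal matrix with diagonal `λ` and superdiagonal `1`. By Cauchy–Binet, total
positivity passes from this production matrix to the triangle and to the Hankel matrix of its first
column. The first columns of such arrays are the Sheffer polynomials: `exp ((λ + q) f)` is the
generating function of `S_n(f, exp (λ f); q)`, and `f(q t) / q` in place of `f` accounts for the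
reciprocal polynomials.

A real sequence with a totally positive Hankel matrix is a Stieltjes moment sequence by the
Riesz–Markov theorem. Exchanging sums and integrals, this reduces the convolutions to geometric
sequences `x` and `y`, for which they are once more evaluations of Sheffer polynomials. The signed
triangles of `f̄` come from inverting `S(f, 1)`, by Jacobi's complementary minor formula. If `φ` is
a product of `m` linear factors, inserting these factors one at a time between `exp (λ f)` and its
derivative yields an Euler–Gauss recurrence, hence the branched continued fraction.
-/

namespace ShefferTP

open Filter Finset

/-! ### The Cauchy–Binet formula -/

section CauchyBinet

variable {R : Type*} [CommRing R]

theorem det_mul_eq_sum_pi {m n : Type*} [Fintype m] [DecidableEq m] [Fintype n]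
    (A : Matrix m n R) (B : Matrix n m R) :
    (A * B).det = ∑ p : m → n, (∏ i, A i (p i)) * (B.submatrix p id).det := by
  classical
  have rows : A * B = fun i => ∑ j, A i j • B j := by
    funext i l
    simp [Matrix.mul_apply]
  let D := (Matrix.detRowAlternating (n := m) (R := R)).toMultilinearMap
  calc (A * B).det = D fun i => ∑ j, A i j • B j := congrArg D rows
    _ = ∑ p : m → n, D fun i => A i (p i) • B (p i) := D.map_sum _
    _ = _ := sum_congr rfl fun p _ => D.map_smul_univ (fun i => A i (p i)) fun i => B (p i)

variable {k : ℕ} {α : Type*} [LinearOrder α]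

theorem orderEmbedding_comp_perm_injective :
    Function.Injective fun x : (Fin k ↪o α) × Equiv.Perm (Fin k) => (x.1 ∘ x.2 : Fin k → α) := by
  rintro ⟨s, σ⟩ ⟨s', σ'⟩ (h : s ∘ σ = s' ∘ σ')
  obtain rfl : s = s' := by
    have range_eq := congrArg Set.range h
    rw [σ.surjective.range_comp, σ'.surjective.range_comp] at range_eq
    exact DFunLike.coe_injective ((s.strictMono.range_inj s'.strictMono).1 range_eq)
  obtain rfl : σ = σ' := Equiv.ext fun i => s.injective (congrFun h i)
  rfl

theorem exists_orderEmbedding_comp_perm {p : Fin k → α} (hp : Function.Injective p) :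
    ∃ (s : Fin k ↪o α) (σ : Equiv.Perm (Fin k)), s ∘ σ = p :=
  have sorted : StrictMono (p ∘ Tuple.sort p) :=
    (Tuple.monotone_sort p).strictMono_of_injective (hp.comp (Tuple.sort p).injective)
  ⟨OrderEmbedding.ofStrictMono _ sorted, (Tuple.sort p)⁻¹, by ext i; simp⟩

theorem sum_eq_sum_orderEmbedding_perm [Fintype α] [Fintype (Fin k ↪o α)] {M : Type*}
    [AddCommMonoid M] (F : (Fin k → α) → M) (hF : ∀ p, ¬ Function.Injective p → F p = 0) :
    ∑ p, F p = ∑ s : Fin k ↪o α, ∑ σ : Equiv.Perm (Fin k), F (s ∘ σ) := by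
  rw [← Fintype.sum_prod_type']
  refine (sum_of_injOn _ orderEmbedding_comp_perm_injective.injOn (by simp) ?_ fun _ _ => rfl).symm
  intro p _ hp
  refine hF p fun hinj => hp ?_
  obtain ⟨s, σ, rfl⟩ := exists_orderEmbedding_comp_perm hinj
  exact ⟨(s, σ), by simp, rfl⟩

theorem det_mul_eq_sum_orderEmbedding [Fintype α] [Fintype (Fin k ↪o α)]
    (A : Matrix (Fin k) α R) (B : Matrix α (Fin k) R) :
    (A * B).det = ∑ s : Fin k ↪o α, (A.submatrix id s).det * (B.submatrix s id).det := by
  rw [det_mul_eq_sum_pi, sum_eq_sum_orderEmbedding_perm]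
  · refine sum_congr rfl fun s _ => ?_
    have det_perm (σ : Equiv.Perm (Fin k)) : (B.submatrix (s ∘ σ) id).det =
        Equiv.Perm.sign σ * (B.submatrix s id).det :=
      Matrix.det_permute σ (B.submatrix s id)
    simp_rw [det_perm, ← Matrix.det_transpose (A.submatrix id s), Matrix.det_apply', sum_mul]
    refine sum_congr rfl fun σ _ => ?_
    simp only [Matrix.transpose_apply, Matrix.submatrix_apply, id, Function.comp_apply]
    ring
  · intro p hp
    obtain ⟨a, b, hab, hne⟩ := Function.not_injective_iff.1 hp
    rw [Matrix.det_zero_of_row_eq hne (by ext l; simp [hab]), mul_zero]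

end CauchyBinet

/-! ### Total positivity relative to a subsemiring -/

section TP

variable {R : Type*} [CommRing R]

/-- Total positivity of an infinite matrix with respect to a subsemiring `P` of "nonnegative"
elements; nonnegativity being closed under sums and products is what Cauchy–Binet needs. -/
abbrev TP (P : Subsemiring R) (M : ℕ → ℕ → R) : Prop := MinorsSatisfy (· ∈ P) M

/-- `M` is the product of the infinite matrices `A` and `B`, whose entries `∑ₗ A i l * B l j` are
required to be finite sums, in the sense that the partial sums are eventually constant. -/
def IsProd (A B M : ℕ → ℕ → R) : Prop :=
  ∀ i j, ∀ᶠ N in atTop, M i j = ∑ l ∈ range N, A i l * B l j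

theorem IsProd.of_eq_sum {A B M : ℕ → ℕ → R} (n : ℕ → ℕ → ℕ)
    (hM : ∀ i j, M i j = ∑ l ∈ range (n i j), A i l * B l j)
    (h0 : ∀ i j l, n i j ≤ l → A i l * B l j = 0) : IsProd A B M := fun i j =>
  eventually_atTop.2 ⟨n i j, fun _ hN => (hM i j).trans (eventually_constant_sum (h0 i j) hN).symm⟩

theorem IsProd.eq_sum {A B M : ℕ → ℕ → R} (h : IsProd A B M) {i j n : ℕ}
    (h0 : ∀ l, n ≤ l → A i l * B l j = 0) : M i j = ∑ l ∈ range n, A i l * B l j := by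
  obtain ⟨N, hN, hnN⟩ := ((h i j).and (eventually_ge_atTop n)).exists
  rw [hN, eventually_constant_sum h0 hnN]

theorem IsProd.assoc {A B C AB BC ABC : ℕ → ℕ → R} (hAB : IsProd A B AB) (hBC : IsProd B C BC)
    (hABC : IsProd AB C ABC) (n : ℕ → ℕ) (hA : ∀ i l, n i ≤ l → A i l = 0) : IsProd A BC ABC := by
  refine .of_eq_sum (fun i _ => n i) (fun i j => ?_) fun i j l hl => by rw [hA i l hl, zero_mul]
  obtain ⟨N, hABCN, hBCN⟩ :=
    ((hABC i j).and ((eventually_all_finset (range (n i))).2 fun m _ => hBC m j)).exists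
  have row_AB (l : ℕ) : AB i l = ∑ m ∈ range (n i), A i m * B m l :=
    hAB.eq_sum fun m hm => by rw [hA i m hm, zero_mul]
  calc ABC i j = ∑ l ∈ range N, ∑ m ∈ range (n i), A i m * B m l * C l j := by
        simp_rw [hABCN, row_AB, sum_mul]
    _ = ∑ m ∈ range (n i), A i m * BC m j := by
        rw [sum_comm]
        refine sum_congr rfl fun m hm => ?_
        simp_rw [hBCN m hm, mul_sum, mul_assoc]

namespace TP

variable {P : Subsemiring R} {A B M : ℕ → ℕ → R}

theorem transpose (h : TP P M) : TP P fun i j => M j i := fun k r c hr hc => by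
  rw [← Matrix.det_transpose]
  exact h k c r hc hr

theorem apply_mem (h : TP P M) (i j : ℕ) : M i j ∈ P := by
  simpa using h 1 (fun _ => i) (fun _ => j) (Subsingleton.strictMono _) (Subsingleton.strictMono _)

theorem submatrix (h : TP P M) {u v : ℕ → ℕ} (hu : StrictMono u) (hv : StrictMono v) :
    TP P fun i j => M (u i) (v j) := fun k r c hr hc =>
  h k (u ∘ r) (v ∘ c) (hu.comp hr) (hv.comp hc)

theorem mul (hA : TP P A) (hB : TP P B) (hM : IsProd A B M) : TP P M := by
  intro k r c hr hc
  obtain ⟨N, hN⟩ : ∃ N, ∀ i j, M (r i) (c j) = ∑ l ∈ range N, A (r i) l * B l (c j) :=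
    (eventually_all.2 fun i => eventually_all.2 fun j => hM (r i) (c j)).exists
  have factor : (Matrix.of fun i j => M (r i) (c j)) =
      (Matrix.of fun (i : Fin k) (l : Fin N) => A (r i) l) *
        (Matrix.of fun (l : Fin N) (j : Fin k) => B l (c j)) := by
    ext i j
    simp [Matrix.mul_apply, hN, sum_range]
  rw [factor, det_mul_eq_sum_orderEmbedding]
  refine sum_mem fun s _ => mul_mem ?_ ?_
  · exact hA k r (fun j => s j) hr (Fin.val_strictMono.comp s.strictMono)
  · exact hB k (fun j => s j) c (Fin.val_strictMono.comp s.strictMono) hc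

theorem map {S : Type*} [CommRing S] {Q : Subsemiring S} (φ : R →+* S)
    (hφ : ∀ x ∈ P, φ x ∈ Q) (h : TP P M) : TP Q fun i j => φ (M i j) := fun k r c hr hc => by
  have := hφ _ (h k r c hr hc)
  rwa [RingHom.map_det] at this

theorem scale (h : TP P M) {u v : ℕ → R} (hu : ∀ i, u i ∈ P) (hv : ∀ j, v j ∈ P) :
    TP P fun i j => u i * M i j * v j := by
  intro k r c hr hc
  have factor : (Matrix.of fun i j => u (r i) * M (r i) (c j) * v (c j)) =
      Matrix.diagonal (u ∘ r) * (Matrix.of fun i j => M (r i) (c j)) *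
        Matrix.diagonal (v ∘ c) := by
    ext i j
    simp
  rw [factor, Matrix.det_mul, Matrix.det_mul, Matrix.det_diagonal, Matrix.det_diagonal]
  exact mul_mem (mul_mem (prod_mem fun _ _ => hu _) (h k r c hr hc)) (prod_mem fun _ _ => hv _)

theorem scale_pow_sub (h : TP P M) (h0 : ∀ i j, i < j → M i j = 0) {w : R} (hw : w ∈ P) :
    TP P fun i j => w ^ (i - j) * M i j := by
  intro k r c hr hc
  suffices (Matrix.of fun i j => w ^ (r i - c j) * M (r i) (c j)).det =
      w ^ (∑ i, r i - ∑ i, c i) * (Matrix.of fun i j => M (r i) (c j)).det by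
    rw [this]
    exact mul_mem (pow_mem hw _) (h k r c hr hc)
  rw [Matrix.det_apply', Matrix.det_apply', mul_sum]
  refine sum_congr rfl fun σ _ => ?_
  simp only [Matrix.of_apply, prod_mul_distrib]
  by_cases hσ : ∀ i, c i ≤ r (σ i)
  · rw [prod_pow_eq_pow_sum, sum_tsub_distrib _ fun i _ => hσ i, Equiv.sum_comp σ r]
    ring
  · push Not at hσ
    obtain ⟨i, hi⟩ := hσ
    rw [prod_eq_zero (f := fun x => M (r (σ x)) (c x)) (mem_univ i) (h0 _ _ hi)]
    simp

end TP

theorem det_eq_mul_det_succ_of_first_row {n : ℕ} (A : Matrix (Fin (n + 1)) (Fin (n + 1)) R)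
    (h : ∀ j : Fin n, A 0 j.succ = 0) :
    A.det = A 0 0 * (A.submatrix Fin.succ Fin.succ).det := by
  rw [Matrix.det_succ_row_zero, Fin.sum_univ_succ]
  simp [h]

theorem det_eq_mul_det_succ_of_first_col {n : ℕ} (A : Matrix (Fin (n + 1)) (Fin (n + 1)) R)
    (h : ∀ i : Fin n, A i.succ 0 = 0) :
    A.det = A 0 0 * (A.submatrix Fin.succ Fin.succ).det := by
  rw [Matrix.det_succ_column_zero, Fin.sum_univ_succ]
  simp [h]

variable {P : Subsemiring R}

/-- The upper bidiagonal matrix `c I + Δ`, with `c` on the diagonal and `1` just above it. -/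
def upperBidiag (c : R) (i j : ℕ) : R := if j = i then c else if j = i + 1 then 1 else 0

theorem upperBidiag_of_lt (c : R) {i j : ℕ} (h : j < i) : upperBidiag c i j = 0 := by
  rw [upperBidiag, if_neg h.ne, if_neg (by omega)]

theorem upperBidiag_of_succ_lt (c : R) {i j : ℕ} (h : i + 1 < j) : upperBidiag c i j = 0 := by
  rw [upperBidiag, if_neg (by omega), if_neg h.ne']

theorem upperBidiag_mem {c : R} (hc : c ∈ P) (i j : ℕ) : upperBidiag c i j ∈ P := by
  unfold upperBidiag
  split_ifs
  exacts [hc, one_mem P, zero_mem P]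

theorem isProd_upperBidiag_left (c : R) (M : ℕ → ℕ → R) :
    IsProd (upperBidiag c) M fun i j => c * M i j + M (i + 1) j :=
  .of_eq_sum (fun i _ => i + 2)
    (fun i j => by
      rw [sum_range_succ, sum_range_succ, sum_eq_zero fun l hl => by
        rw [upperBidiag_of_lt c (mem_range.1 hl), zero_mul]]
      simp [upperBidiag])
    fun i j l hl => by rw [upperBidiag_of_succ_lt c hl, zero_mul]

theorem isProd_upperBidiag_right (c : R) (M : ℕ → ℕ → R) :
    IsProd M (upperBidiag c) fun i j => c * M i j + if j = 0 then 0 else M i (j - 1) := by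
  refine .of_eq_sum (fun _ j => j + 1) (fun i j => ?_)
    fun i j l hl => by rw [upperBidiag_of_lt c hl, mul_zero]
  rcases j with _ | j
  · simp [upperBidiag, mul_comm]
  · rw [sum_range_succ, sum_range_succ, sum_eq_zero fun l hl => by
      rw [upperBidiag_of_succ_lt c (Nat.succ_lt_succ (mem_range.1 hl)), mul_zero]]
    simp [upperBidiag, mul_comm, add_comm]

theorem tp_upperBidiag {c : R} (hc : c ∈ P) : TP P (upperBidiag c) := by
  intro k
  induction k with
  | zero => intro r s _ _; simp
  | succ k ih =>
    intro r s hr hs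
    have corner_mul_mem := mul_mem (upperBidiag_mem hc (r 0) (s 0))
      (ih (r ∘ Fin.succ) (s ∘ Fin.succ) (hr.comp Fin.strictMono_succ) (hs.comp Fin.strictMono_succ))
    rcases lt_trichotomy (s 0) (r 0) with h | h | h
    · rw [Matrix.det_eq_zero_of_column_eq_zero (0 : Fin (k + 1)) fun i =>
        upperBidiag_of_lt c (h.trans_le (hr.monotone (Fin.zero_le i)))]
      exact zero_mem P
    · rwa [det_eq_mul_det_succ_of_first_col _ fun i =>
        upperBidiag_of_lt c (h.trans_lt (hr (Fin.succ_pos i)))]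
    · rwa [det_eq_mul_det_succ_of_first_row _ fun j =>
        upperBidiag_of_succ_lt c (Nat.lt_of_le_of_lt h (hs (Fin.succ_pos j)))]

/-! ### Production matrices -/

theorem tp_zero : TP P fun _ _ => 0 := by
  rintro (_ | k) r c - -
  · simp
  · rw [Matrix.det_eq_zero_of_row_eq_zero 0 fun _ => rfl]
    exact zero_mem P

/-- The matrix `M` with the row `(a, 0, 0, …)` put on top of it. -/
def consRow (a : R) (M : ℕ → ℕ → R) : ℕ → ℕ → R
  | 0, j => if j = 0 then a else 0
  | i + 1, j => M i j

theorem TP.consRow {a : R} {M : ℕ → ℕ → R} (ha : a ∈ P) (hM : TP P M) :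
    TP P (ShefferTP.consRow a M) := by
  have positive_rows (k : ℕ) (r c : Fin k → ℕ) (hr : StrictMono r) (hc : StrictMono c)
      (h : ∀ i, 0 < r i) : (Matrix.of fun i j => ShefferTP.consRow a M (r i) (c j)).det ∈ P := by
    obtain ⟨r', rfl⟩ : ∃ r' : Fin k → ℕ, r = fun i => r' i + 1 :=
      ⟨fun i => r i - 1, funext fun i => (Nat.sub_add_cancel (h i)).symm⟩
    exact hM k r' c (fun i j hij => Nat.lt_of_succ_lt_succ (hr hij)) hc
  rintro (_ | k) r c hr hc
  · simp
  rcases Nat.eq_zero_or_pos (r 0) with h | h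
  · rw [det_eq_mul_det_succ_of_first_row]
    · refine mul_mem ?_ (positive_rows k (r ∘ Fin.succ) (c ∘ Fin.succ)
        (hr.comp Fin.strictMono_succ) (hc.comp Fin.strictMono_succ)
        fun i => pos_of_gt (hr (Fin.succ_pos i)))
      simp only [Matrix.of_apply, h, ShefferTP.consRow]
      split_ifs
      exacts [ha, zero_mem P]
    · intro j
      simp [h, ShefferTP.consRow, (pos_of_gt (hc (Fin.succ_pos j))).ne']
  · exact positive_rows _ r c hr hc fun i => h.trans_le (hr.monotone (Fin.zero_le i))

/-- In the terminology of production matrices, `O` is the output matrix of `Q`. -/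
theorem TP.of_production {Q O : ℕ → ℕ → R} (hQ : TP P Q) (h00 : O 0 0 ∈ P)
    (h0 : ∀ j, O 0 (j + 1) = 0) (hO : IsProd O Q fun i j => O (i + 1) j) : TP P O := by
  have truncation (K : ℕ) : TP P fun i j => if i < K then O i j else 0 := by
    induction K with
    | zero => simpa using tp_zero
    | succ K ih =>
      have step : TP P fun i j => if i < K then O (i + 1) j else 0 :=
        ih.mul hQ fun i j => (hO i j).mono fun N hN => by split_ifs with h <;> simp [h, hN]
      convert step.consRow h00 using 3 with i j
      rcases i with _ | i
      · rcases j with _ | j <;> simp [ShefferTP.consRow, h0]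
      · simp [ShefferTP.consRow]
  intro k r c hr hc
  have bound (i : Fin k) : r i < ∑ i, r i + 1 :=
    Nat.lt_succ_of_le (single_le_sum (fun _ _ => Nat.zero_le _) (mem_univ i))
  simpa [bound] using truncation (∑ i, r i + 1) k r c hr hc

/-- The column `(Q ^ j)_{k, 0}`, as a function of `j` and `k`, for a lower Hessenberg matrix `Q`. -/
def powColumn (Q : ℕ → ℕ → R) : ℕ → ℕ → R
  | 0, k => if k = 0 then 1 else 0
  | j + 1, k => ∑ l ∈ range (k + 2), powColumn Q j l * Q k l

theorem TP.powColumn {Q : ℕ → ℕ → R} (hQ : TP P Q) (hH : ∀ i j, i + 1 < j → Q i j = 0) :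
    TP P (powColumn Q) :=
  TP.of_production hQ.transpose (by simp [ShefferTP.powColumn, one_mem])
    (by simp [ShefferTP.powColumn])
    (.of_eq_sum (fun _ k => k + 2) (fun _ _ => rfl) fun _ k l hl => by rw [hH k l hl, mul_zero])

theorem apply_add_zero_eq_sum_powColumn {Q O : ℕ → ℕ → R} (hH : ∀ i j, i + 1 < j → Q i j = 0)
    (hO0 : ∀ i j, i < j → O i j = 0) (hO : IsProd O Q fun i j => O (i + 1) j) (i j : ℕ) :
    O (i + j) 0 = ∑ l ∈ range (i + 1), O i l * powColumn Q j l := by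
  induction j generalizing i with
  | zero => simp [powColumn]
  | succ j ih =>
    have next_row (k : ℕ) : O (i + 1) k = ∑ l ∈ range (i + 1), O i l * Q l k :=
      hO.eq_sum fun l hl => by rw [hO0 i l hl, zero_mul]
    have powColumn_succ (l : ℕ) (hl : l ∈ range (i + 1)) :
        powColumn Q (j + 1) l = ∑ k ∈ range (i + 2), powColumn Q j k * Q l k :=
      (eventually_constant_sum (fun k hk => by rw [hH l k hk, mul_zero])
        (by simpa using hl)).symm
    calc O (i + (j + 1)) 0 = ∑ k ∈ range (i + 2), O (i + 1) k * powColumn Q j k := by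
          rw [← ih, add_right_comm, add_assoc]
      _ = ∑ l ∈ range (i + 1), ∑ k ∈ range (i + 2), O i l * (powColumn Q j k * Q l k) := by
          simp_rw [next_row, sum_mul]
          rw [sum_comm]
          exact sum_congr rfl fun l _ => sum_congr rfl fun k _ => by ring
      _ = ∑ l ∈ range (i + 1), O i l * powColumn Q (j + 1) l :=
          sum_congr rfl fun l hl => by rw [powColumn_succ l hl, mul_sum]

/-- `O_{i+j,0} = ∑ₗ O_{i,l} (Q ^ j)_{l,0}` factors the Hankel matrix into two output matrices. -/
theorem TP.hankel_of_production {Q O : ℕ → ℕ → R} (hQ : TP P Q)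
    (hH : ∀ i j, i + 1 < j → Q i j = 0) (h00 : O 0 0 ∈ P) (hO0 : ∀ i j, i < j → O i j = 0)
    (hO : IsProd O Q fun i j => O (i + 1) j) : TP P fun i j => O (i + j) 0 :=
  (of_production hQ h00 (fun j => hO0 _ _ (Nat.succ_pos j)) hO).mul (hQ.powColumn hH).transpose
    (.of_eq_sum (fun i _ => i + 1) (apply_add_zero_eq_sum_powColumn hH hO0 hO)
      fun i _ l hl => by rw [hO0 i l hl, zero_mul])

/-! ### Log-convexity of order three -/

theorem logConvexOp_iterate_two (a : ℕ → R) (i : ℕ) :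
    (logConvexOp^[2] a) i = a (i + 2) * (Matrix.of fun k l : Fin 3 => a (i + k + l)).det := by
  simp only [Function.iterate_succ, Function.iterate_zero, Function.comp, id, logConvexOp,
    Matrix.det_fin_three, Matrix.of_apply, Fin.coe_ofNat_eq_mod, Nat.zero_mod, add_zero,
    Nat.one_mod, Nat.mod_succ]
  ring_nf

theorem logConvexOp_iterate_three (a : ℕ → R) (i : ℕ) :
    (logConvexOp^[3] a) i =
      logConvexOp a (i + 2) * ((Matrix.of fun k l : Fin 3 => a (i + k + l)).det *
        (Matrix.of fun k l : Fin 3 => a (i + 2 + k + l)).det) + a (i + 3) ^ 2 *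
        (logConvexOp a (i + 2) * (Matrix.of fun k l : Fin 4 => a (i + k + l)).det) := by
  simp only [Function.iterate_succ, Function.iterate_zero, Function.comp, id,
    logConvexOp, Matrix.det_fin_three, Matrix.det_succ_row_zero (n := 3), Fin.sum_univ_four,
    Matrix.submatrix_apply, Matrix.of_apply]
  simp [Fin.succAbove]
  ring_nf

theorem TP.isLogConvexOfOrder_three {a : ℕ → R} (h : TP P fun i j => a (i + j)) :
    IsLogConvexOfOrder (· ∈ P) 3 a := by
  have hankel_minor (n m : ℕ) : (Matrix.of fun i j : Fin n => a (m + i + j)).det ∈ P :=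
    h n (fun i => m + i) (fun i => i) (fun _ _ hij => by simpa using hij) Fin.val_strictMono
  have term (i : ℕ) : a i ∈ P := h.apply_mem i 0
  have op (i : ℕ) : logConvexOp a i ∈ P := by
    convert hankel_minor 2 i using 1
    simp only [logConvexOp, Matrix.det_fin_two, Matrix.of_apply, Fin.coe_ofNat_eq_mod,
      Nat.zero_mod, Nat.mod_succ, add_zero]
    ring
  intro m hm i
  interval_cases m
  · exact term i
  · exact op i
  · rw [logConvexOp_iterate_two]
    exact mul_mem (term _) (hankel_minor 3 i)
  · rw [logConvexOp_iterate_three]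
    exact add_mem (mul_mem (op _) (mul_mem (hankel_minor 3 _) (hankel_minor 3 _)))
      (mul_mem (pow_mem (term _) 2) (mul_mem (op _) (hankel_minor 4 _)))

end TP

/-! ### Jacobi's complementary minor formula -/

section Jacobi

variable {k m : ℕ}

theorem val_inl_eq_add_card_of_strictMono {e : Fin k ⊕ Fin m ≃ Fin (k + m)}
    (hl : StrictMono (e ∘ Sum.inl)) (i : Fin k) :
    (e (Sum.inl i) : ℕ) = i + #{j : Fin m | e (Sum.inr j) < e (Sum.inl i)} := by
  have left_block : #{x : Fin k | e (Sum.inl x) < e (Sum.inl i)} = i := by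
    rw [← Fin.card_Iio i]
    congr 1
    ext x
    simpa using hl.lt_iff_lt (a := x) (b := i)
  calc (e (Sum.inl i) : ℕ) = #{x : Fin (k + m) | x < e (Sum.inl i)} := by
        rw [← Fin.card_Iio (e (Sum.inl i))]
        congr 1
        ext x
        simp
    _ = #{x : Fin k | e (Sum.inl x) < e (Sum.inl i)} +
          #{j : Fin m | e (Sum.inr j) < e (Sum.inl i)} := by
        simp only [card_filter, ← Equiv.sum_comp e, Fintype.sum_sum_type]
    _ = _ := by rw [left_block]

theorem sign_eq_prod_of_strictMono {e : Fin k ⊕ Fin m ≃ Fin (k + m)}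
    (hl : StrictMono (e ∘ Sum.inl)) (hr : StrictMono (e ∘ Sum.inr)) :
    Equiv.Perm.sign (finSumFinEquiv.symm.trans e) =
      ∏ i : Fin k, ∏ j : Fin m, if e (Sum.inr j) < e (Sum.inl i) then -1 else 1 := by
  have Iio_eq (j : Fin (k + m)) : Iio j = ({i | i < j} : Finset (Fin (k + m))) := by ext; simp
  have cross_lt (i : Fin k) (j : Fin m) : Fin.castAdd m i < Fin.natAdd k j :=
    Fin.lt_def.2 (by simpa using Nat.lt_add_right _ i.2)
  have left_left (i i' : Fin k) : (if i < i' then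
      if e (Sum.inl i) < e (Sum.inl i') then (1 : ℤˣ) else -1 else 1) = 1 := by
    split_ifs with h h'
    exacts [rfl, absurd (hl h) h', rfl]
  have right_right (j j' : Fin m) : (if j < j' then
      if e (Sum.inr j) < e (Sum.inr j') then (1 : ℤˣ) else -1 else 1) = 1 := by
    split_ifs with h h'
    exacts [rfl, absurd (hr h) h', rfl]
  have left_right (i : Fin k) (j : Fin m) :
      (if e (Sum.inl i) < e (Sum.inr j) then (1 : ℤˣ) else -1) =
        if e (Sum.inr j) < e (Sum.inl i) then -1 else 1 := by
    have ne : e (Sum.inl i) ≠ e (Sum.inr j) := e.injective.ne Sum.inl_ne_inr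
    rcases lt_or_gt_of_ne ne with h | h
    · rw [if_pos h, if_neg h.asymm]
    · rw [if_neg h.asymm, if_pos h]
  simp only [Equiv.Perm.sign_eq_prod_prod_Iio, Iio_eq, prod_filter, Fin.prod_univ_add,
    Equiv.trans_apply, finSumFinEquiv_symm_apply_castAdd, finSumFinEquiv_symm_apply_natAdd,
    (Fin.strictMono_castAdd m).lt_iff_lt, Fin.natAdd_lt_natAdd_iff, cross_lt, (cross_lt _ _).asymm,
    if_true, if_false, left_left, right_right, left_right, prod_const_one, one_mul, mul_one]
  exact Finset.prod_comm

theorem sign_eq_neg_one_pow_of_strictMono {e : Fin k ⊕ Fin m ≃ Fin (k + m)}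
    (hl : StrictMono (e ∘ Sum.inl)) (hr : StrictMono (e ∘ Sum.inr)) :
    Equiv.Perm.sign (finSumFinEquiv.symm.trans e) =
      (-1) ^ (∑ i : Fin k, (e (Sum.inl i) : ℕ) + ∑ i : Fin k, (i : ℕ)) := by
  rw [sign_eq_prod_of_strictMono hl hr, ← sum_add_distrib, ← prod_pow_eq_pow_sum]
  refine prod_congr rfl fun i _ => ?_
  rw [prod_ite, prod_const_one, mul_one, prod_const, val_inl_eq_add_card_of_strictMono hl i]
  exact neg_one_pow_congr (by grind)

theorem exists_finSumEquiv_of_strictMono {s : Fin k → ℕ} (hs : StrictMono s)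
    (hlt : ∀ i, s i < k + m) :
    ∃ e : Fin k ⊕ Fin m ≃ Fin (k + m), (∀ i, (e (Sum.inl i) : ℕ) = s i) ∧
      StrictMono (e ∘ Sum.inl) ∧ StrictMono (e ∘ Sum.inr) := by
  let s' : Fin k → Fin (k + m) := fun i => ⟨s i, hlt i⟩
  have hs' : StrictMono s' := fun i j hij => hs hij
  have card_image : (univ.image s').card = k := by
    simp [card_image_of_injective _ hs'.injective]
  have card_compl : (univ.image s')ᶜ.card = m := by
    simp [Finset.card_compl, card_image]
  refine ⟨finSumEquivOfFinset card_image card_compl, fun i => ?_, fun i j hij => ?_,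
    fun i j hij => ?_⟩
  · rw [finSumEquivOfFinset_inl, ← orderEmbOfFin_unique card_image (fun x => by simp) hs']
  · simpa using hij
  · simpa using hij

variable {R : Type*} [CommRing R]

theorem det_submatrix_equiv_mul_det_of_mul_eq_one {A B : Matrix (Fin (k + m)) (Fin (k + m)) R}
    (hAB : A * B = 1) (e f : Fin k ⊕ Fin m ≃ Fin (k + m)) :
    (A.submatrix f e).det * (B.submatrix (e ∘ Sum.inl) (f ∘ Sum.inl)).det =
      (A.submatrix (f ∘ Sum.inr) (e ∘ Sum.inr)).det := by
  have inverse : A.submatrix f e * B.submatrix e f = 1 := by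
    rw [Matrix.submatrix_mul_equiv, hAB, Matrix.submatrix_one_equiv]
  have blocks : A.submatrix f e *
      Matrix.fromBlocks (B.submatrix (e ∘ Sum.inl) (f ∘ Sum.inl)) 0
        (B.submatrix (e ∘ Sum.inr) (f ∘ Sum.inl)) 1 =
      Matrix.fromBlocks 1 (A.submatrix (f ∘ Sum.inl) (e ∘ Sum.inr)) 0
        (A.submatrix (f ∘ Sum.inr) (e ∘ Sum.inr)) := by
    ext i (j | j)
    · have := congrFun (congrFun inverse i) (Sum.inl j)
      rw [Matrix.mul_apply, Fintype.sum_sum_type] at this ⊢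
      rcases i with i | i <;> simpa [Matrix.one_apply] using this
    · rw [Matrix.mul_apply, Fintype.sum_sum_type]
      rcases i with i | i <;> simp [Matrix.one_apply]
  have := congrArg Matrix.det blocks
  rwa [Matrix.det_mul, Matrix.det_fromBlocks_zero₁₂, Matrix.det_fromBlocks_zero₂₁, Matrix.det_one,
    Matrix.det_one, mul_one, one_mul] at this

theorem det_submatrix_equiv_eq_neg_one_pow_mul_det (A : Matrix (Fin (k + m)) (Fin (k + m)) R)
    {e f : Fin k ⊕ Fin m ≃ Fin (k + m)}
    (hel : StrictMono (e ∘ Sum.inl)) (her : StrictMono (e ∘ Sum.inr))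
    (hfl : StrictMono (f ∘ Sum.inl)) (hfr : StrictMono (f ∘ Sum.inr)) :
    (A.submatrix f e).det =
      (-1) ^ (∑ i : Fin k, (e (Sum.inl i) : ℕ) + ∑ i : Fin k, (f (Sum.inl i) : ℕ)) * A.det := by
  have relative : Equiv.Perm.sign (e.symm.trans f) =
      (-1) ^ (∑ i : Fin k, (e (Sum.inl i) : ℕ) + ∑ i : Fin k, (f (Sum.inl i) : ℕ)) := by
    have : e.symm.trans f =
        (finSumFinEquiv.symm.trans e).symm.trans (finSumFinEquiv.symm.trans f) := by
      ext; simp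
    rw [this, Equiv.Perm.sign_trans, Equiv.Perm.sign_symm,
      sign_eq_neg_one_pow_of_strictMono hel her, sign_eq_neg_one_pow_of_strictMono hfl hfr,
      ← pow_add]
    exact neg_one_pow_congr (by grind)
  have permuted : A.submatrix f e = (A.submatrix (e.symm.trans f) id).submatrix e e := by
    ext; simp
  rw [permuted, Matrix.det_submatrix_equiv_self, Matrix.det_permute, relative]
  push_cast
  rfl

theorem det_mul_det_submatrix_of_mul_eq_one {A B : Matrix (Fin (k + m)) (Fin (k + m)) R}
    (hAB : A * B = 1) {e f : Fin k ⊕ Fin m ≃ Fin (k + m)}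
    (hel : StrictMono (e ∘ Sum.inl)) (her : StrictMono (e ∘ Sum.inr))
    (hfl : StrictMono (f ∘ Sum.inl)) (hfr : StrictMono (f ∘ Sum.inr)) :
    A.det * ((-1) ^ (∑ i : Fin k, (e (Sum.inl i) : ℕ) + ∑ i : Fin k, (f (Sum.inl i) : ℕ)) *
        (B.submatrix (e ∘ Sum.inl) (f ∘ Sum.inl)).det) =
      (A.submatrix (f ∘ Sum.inr) (e ∘ Sum.inr)).det := by
  rw [← det_submatrix_equiv_mul_det_of_mul_eq_one hAB,
    det_submatrix_equiv_eq_neg_one_pow_mul_det A hel her hfl hfr]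
  ring

theorem det_signed {k : ℕ} (M : ℕ → ℕ → ℝ) (r c : Fin k → ℕ) :
    (Matrix.of fun i j => signed M (r i) (c j)).det =
      (-1) ^ (∑ i, r i + ∑ i, c i) * (Matrix.of fun i j => M (r i) (c j)).det := by
  have factor : (Matrix.of fun i j => signed M (r i) (c j)) =
      Matrix.diagonal (fun i => (-1) ^ r i) * (Matrix.of fun i j => M (r i) (c j)) *
        Matrix.diagonal (fun j => (-1) ^ c j) := by
    ext i j
    simp only [signed, Matrix.mul_diagonal, Matrix.diagonal_mul, Matrix.of_apply]
    ring
  rw [factor, Matrix.det_mul, Matrix.det_mul, Matrix.det_diagonal, Matrix.det_diagonal,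
    prod_pow_eq_pow_sum, prod_pow_eq_pow_sum]
  ring

theorem TP.signed_of_isProd_one {M N : ℕ → ℕ → ℝ} (hM : TP (Subsemiring.nonneg ℝ) M)
    (hM0 : ∀ i j, i < j → M i j = 0) (hdiag : ∀ i, M i i ≠ 0)
    (hMN : IsProd M N fun i j => if i = j then 1 else 0) :
    TP (Subsemiring.nonneg ℝ) (signed N) := by
  intro k r c hr hc
  set m := ∑ i, r i + ∑ i, c i + 1
  have r_lt (i : Fin k) : r i < k + m := by
    have := single_le_sum (f := r) (fun _ _ => Nat.zero_le _) (mem_univ i)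
    omega
  have c_lt (i : Fin k) : c i < k + m := by
    have := single_le_sum (f := c) (fun _ _ => Nat.zero_le _) (mem_univ i)
    omega
  obtain ⟨e, he, hel, her⟩ := exists_finSumEquiv_of_strictMono hr r_lt
  obtain ⟨f, hf, hfl, hfr⟩ := exists_finSumEquiv_of_strictMono hc c_lt
  let A : Matrix (Fin (k + m)) (Fin (k + m)) ℝ := Matrix.of fun i j => M i j
  let B : Matrix (Fin (k + m)) (Fin (k + m)) ℝ := Matrix.of fun i j => N i j
  have hAB : A * B = 1 := by
    ext i j
    have := hMN.eq_sum (i := i) (j := j) (n := k + m)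
      fun l hl => by rw [hM0 i l (i.2.trans_le hl), zero_mul]
    simpa [A, B, Matrix.mul_apply, Matrix.one_apply, sum_range, Fin.ext_iff] using this.symm
  have det_pos : 0 < A.det := by
    rw [Matrix.det_of_isLowerTriangular A fun i j hij => hM0 i j hij]
    exact prod_pos fun i _ => (hM.apply_mem i i).lt_of_ne' (hdiag i)
  have minor : B.submatrix (e ∘ Sum.inl) (f ∘ Sum.inl) = Matrix.of fun i j => N (r i) (c j) := by
    ext i j
    simp [B, he, hf]
  rw [Subsemiring.mem_nonneg, det_signed]
  refine nonneg_of_mul_nonneg_right ?_ det_pos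
  have jacobi := det_mul_det_submatrix_of_mul_eq_one hAB hel her hfl hfr
  simp only [minor, he, hf] at jacobi
  rw [jacobi]
  exact hM m (fun i => f (Sum.inr i)) (fun i => e (Sum.inr i)) (fun i j hij => hfr hij)
    fun i j hij => her hij

end Jacobi

/-! ### The Stieltjes moment problem -/

section Stieltjes

open MeasureTheory Topology
open scoped NNReal ENNReal CompactlySupported

theorem exists_forall_eval_le {p : Polynomial ℝ} (hp : ∀ x, 0 ≤ x → 0 ≤ p.eval x)
    (hdeg : 0 < p.natDegree) : ∃ a, 0 ≤ a ∧ ∀ x, 0 ≤ x → p.eval a ≤ p.eval x := by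
  have tendsto_abs : Tendsto (fun x => |p.eval x|) atTop atTop :=
    p.abs_tendsto_atTop (Polynomial.natDegree_pos_iff_degree_pos.1 hdeg)
  obtain ⟨K, hK⟩ := eventually_atTop.1 (tendsto_abs.eventually_ge_atTop (p.eval 0))
  obtain ⟨a, ha, hmin⟩ := (isCompact_Icc (a := (0 : ℝ)) (b := max K 0)).exists_isMinOn
    ⟨0, by simp⟩ p.continuous.continuousOn
  refine ⟨a, ha.1, fun x hx => ?_⟩
  rcases le_total x (max K 0) with h | h
  · exact hmin ⟨hx, h⟩
  · calc p.eval a ≤ p.eval 0 := hmin ⟨le_rfl, le_max_right _ _⟩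
      _ ≤ |p.eval x| := hK x ((le_max_left _ _).trans h)
      _ = p.eval x := abs_of_nonneg (hp x hx)

theorem eval_nonneg_of_eval_mul_nonneg {D r : Polynomial ℝ} {a : ℝ}
    (hD : ∀ x, 0 ≤ x → x ≠ a → 0 < D.eval x) (h : ∀ x, 0 ≤ x → 0 ≤ (D * r).eval x) :
    ∀ x, 0 ≤ x → 0 ≤ r.eval x := by
  have off_root (x : ℝ) (hx : 0 ≤ x) (hxa : x ≠ a) : 0 ≤ r.eval x :=
    nonneg_of_mul_nonneg_right (by simpa using h x hx) (hD x hx hxa)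
  intro x hx
  have tendsto_right : Tendsto (fun y => r.eval y) (𝓝[>] x) (𝓝 (r.eval x)) :=
    r.continuous.continuousAt.mono_left nhdsWithin_le_nhds
  rcases eq_or_ne x a with rfl | hxa
  · exact ge_of_tendsto tendsto_right (eventually_nhdsWithin_of_forall fun y hy =>
      off_root y (hx.trans (le_of_lt hy)) (ne_of_gt hy))
  · exact off_root x hx hxa

theorem X_sub_C_sq_dvd_of_isLocalMin {p : Polynomial ℝ} {a : ℝ}
    (h : IsLocalMin (fun x => p.eval x) a) :
    (Polynomial.X - Polynomial.C a) ^ 2 ∣ p - Polynomial.C (p.eval a) := by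
  rcases eq_or_ne (p - Polynomial.C (p.eval a)) 0 with h0 | h0
  · exact h0 ▸ dvd_zero _
  rw [← Polynomial.le_rootMultiplicity_iff h0]
  refine (Polynomial.one_lt_rootMultiplicity_iff_isRoot h0).2 ⟨by simp, ?_⟩
  have := h.deriv_eq_zero
  rw [Polynomial.deriv] at this
  simpa using this

theorem exists_eq_C_add_mul {p : Polynomial ℝ} (hp : ∀ x, 0 ≤ x → 0 ≤ p.eval x)
    (hdeg : 0 < p.natDegree) :
    ∃ (c : ℝ) (D r : Polynomial ℝ), 0 ≤ c ∧ (D = Polynomial.X ∨ IsSquare D) ∧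
      p = Polynomial.C c + D * r ∧ r.natDegree < p.natDegree ∧ ∀ x, 0 ≤ x → 0 ≤ r.eval x := by
  obtain ⟨a, ha, hmin⟩ := exists_forall_eval_le hp hdeg
  obtain ⟨D, D_eq, monic, D_deg, D_pos, r, hr⟩ : ∃ D : Polynomial ℝ,
      (D = Polynomial.X ∨ IsSquare D) ∧ D.Monic ∧ 0 < D.natDegree ∧
      (∀ x, 0 ≤ x → x ≠ a → 0 < D.eval x) ∧ D ∣ p - Polynomial.C (p.eval a) := by
    rcases ha.eq_or_lt with rfl | ha
    · refine ⟨Polynomial.X, .inl rfl, Polynomial.monic_X, by simp, fun x hx hx0 => ?_, ?_⟩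
      · simpa using hx.lt_of_ne' hx0
      · simp [Polynomial.X_dvd_iff, Polynomial.coeff_zero_eq_eval_zero]
    · refine ⟨(Polynomial.X - Polynomial.C a) ^ 2, .inr (IsSquare.sq _),
        (Polynomial.monic_X_sub_C a).pow 2, by simp, fun x _ hxa => ?_, ?_⟩
      · simpa using pow_pos (abs_pos.2 (sub_ne_zero.2 hxa)) 2
      · exact X_sub_C_sq_dvd_of_isLocalMin
          ((eventually_ge_nhds ha).mono fun x hx => hmin x hx)
  refine ⟨p.eval a, D, r, hp a ha, D_eq, by rw [← hr]; ring, ?_,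
    eval_nonneg_of_eval_mul_nonneg D_pos fun x hx => ?_⟩
  · rcases eq_or_ne r 0 with rfl | hr0
    · simpa using hdeg
    · have := congrArg Polynomial.natDegree hr
      rw [Polynomial.natDegree_sub_C, monic.natDegree_mul' hr0] at this
      omega
  · simpa [← hr] using hmin x hx

theorem exists_isSumSq_add_X_mul_isSumSq {p : Polynomial ℝ}
    (hp : ∀ x, 0 ≤ x → 0 ≤ p.eval x) :
    ∃ σ τ : Polynomial ℝ, IsSumSq σ ∧ IsSumSq τ ∧ p = σ + Polynomial.X * τ := by
  have isSumSq_C {c : ℝ} (hc : 0 ≤ c) : IsSumSq (Polynomial.C c) := by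
    rw [← Real.mul_self_sqrt hc, Polynomial.C_mul]
    exact .mul_self _
  induction hn : p.natDegree using Nat.strong_induction_on generalizing p with
  | _ n ih =>
    rcases Nat.eq_zero_or_pos p.natDegree with h0 | hpos
    · rw [Polynomial.eq_C_of_natDegree_eq_zero h0]
      refine ⟨Polynomial.C (p.coeff 0), 0, isSumSq_C ?_, .zero, by simp⟩
      simpa [Polynomial.coeff_zero_eq_eval_zero] using hp 0 le_rfl
    obtain ⟨c, D, r, hc, hD, rfl, hdeg, hr⟩ := exists_eq_C_add_mul hp hpos
    obtain ⟨σ, τ, hσ, hτ, rfl⟩ := ih _ (hn ▸ hdeg) hr rfl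
    rcases hD with rfl | hD
    · exact ⟨Polynomial.C c + Polynomial.X * Polynomial.X * τ, σ,
        (isSumSq_C hc).add ((IsSumSq.mul_self _).mul hτ), hσ, by ring⟩
    · exact ⟨Polynomial.C c + D * σ, D * τ, (isSumSq_C hc).add (hD.isSumSq.mul hσ),
        hD.isSumSq.mul hτ, by ring⟩

theorem map_nonneg_of_sq_nonneg {p : Polynomial ℝ} (hp : ∀ x, 0 ≤ x → 0 ≤ p.eval x)
    {L : Polynomial ℝ →ₗ[ℝ] ℝ} (hL : ∀ s, 0 ≤ L (s ^ 2))
    (hLX : ∀ s, 0 ≤ L (Polynomial.X * s ^ 2)) : 0 ≤ L p := by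
  obtain ⟨σ, τ, hσ, hτ, rfl⟩ := exists_isSumSq_add_X_mul_isSumSq hp
  clear hp
  rw [map_add]
  refine add_nonneg ?_ ?_
  · induction hσ with
    | zero => simp
    | sq_add s _ ih => rw [map_add, ← sq]; exact add_nonneg (hL s) ih
  · induction hτ with
    | zero => simp
    | sq_add s _ ih => rw [mul_add, map_add, ← sq]; exact add_nonneg (hLX s) ih

/-- The pairs `(p, h)` of a polynomial and a compactly supported function on `[0, ∞)` with
`p + h ≥ 0`: the cone along which functionals are extended in Haviland's theorem. -/
def nonnegSumCone : PointedCone ℝ (Polynomial ℝ × C_c(ℝ≥0, ℝ)) where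
  carrier := {u | ∀ x : ℝ≥0, 0 ≤ u.1.eval (x : ℝ) + u.2 x}
  zero_mem' := by simp
  smul_mem' c u hu x := by
    have smul_snd : (c • u).2 x = (c : ℝ) * u.2 x := rfl
    have smul_fst : (c • u).1 = (c : ℝ) • u.1 := rfl
    rw [smul_snd, smul_fst, Polynomial.eval_smul, smul_eq_mul, ← mul_add]
    exact mul_nonneg c.2 (hu x)
  add_mem' {u v} hu hv x := by
    have add_snd : (u + v).2 x = u.2 x + v.2 x := rfl
    rw [add_snd, Prod.fst_add, Polynomial.eval_add]
    linarith [hu x, hv x]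

theorem exists_positiveLinearMap_of_map_nonneg (L : Polynomial ℝ →ₗ[ℝ] ℝ)
    (hL : ∀ p : Polynomial ℝ, (∀ x, 0 ≤ x → 0 ≤ p.eval x) → 0 ≤ L p) :
    ∃ Λ : C_c(ℝ≥0, ℝ) →ₚ[ℝ] ℝ, ∀ p h,
      ((∀ x : ℝ≥0, h x ≤ p.eval (x : ℝ)) → Λ h ≤ L p) ∧
      ((∀ x : ℝ≥0, p.eval (x : ℝ) ≤ h x) → L p ≤ Λ h) := by
  let D := LinearMap.ker (LinearMap.snd ℝ (Polynomial ℝ) C_c(ℝ≥0, ℝ))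
  have mem_D (p) : (p, (0 : C_c(ℝ≥0, ℝ))) ∈ D := by simp [D]
  obtain ⟨g, g_ext, g_nonneg⟩ := riesz_extension nonnegSumCone
    ⟨D, (L.comp (LinearMap.fst ℝ (Polynomial ℝ) C_c(ℝ≥0, ℝ))).domRestrict D⟩
    (by
      rintro ⟨⟨p, h⟩, hph⟩ hs
      obtain rfl : h = 0 := hph
      exact hL p fun x hx => (hs ⟨x, hx⟩).trans_eq (add_zero _))
    (by
      rintro ⟨p, h⟩
      obtain ⟨K, hK⟩ := h.continuous.bounded_above_of_compact_support h.hasCompactSupport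
      refine ⟨⟨(-p + Polynomial.C K, 0), mem_D _⟩, fun x => ?_⟩
      have bound : -K ≤ h x := (abs_le.1 (hK x)).1
      have sum_eq : ((-p + Polynomial.C K, (0 : C_c(ℝ≥0, ℝ))) + (p, h)) =
          (Polynomial.C K, h) := by ext <;> simp
      simp only [sum_eq, Polynomial.eval_C]
      linarith)
  have g_apply (p h) : g (p, h) = L p + g (0, h) := by
    have g_fst : g (p, 0) = L p := g_ext ⟨(p, 0), mem_D p⟩
    rw [← g_fst, ← map_add]
    simp
  have g_neg (h) : g (0, -h) = -g (0, h) := by rw [← map_neg]; simp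
  have nonneg_of (p h) (hph : ∀ x : ℝ≥0, 0 ≤ p.eval (x : ℝ) + h x) : 0 ≤ L p + g (0, h) :=
    g_apply p h ▸ g_nonneg (p, h) hph
  refine ⟨PositiveLinearMap.mk₀ (g.comp (LinearMap.inr ℝ _ _)) fun h hh => ?_, fun p h => ⟨?_, ?_⟩⟩
  · simpa using nonneg_of 0 h fun x => by simpa using hh x
  · intro hle
    have := nonneg_of p (-h) fun x => by simpa using hle x
    rw [g_neg] at this
    change g (0, h) ≤ L p
    linarith
  · intro hle
    have := nonneg_of (-p) h fun x => by simpa using hle x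
    rw [map_neg] at this
    change L p ≤ g (0, h)
    linarith

/-- The continuous cutoff equal to `1` on `[0, n]` and to `0` on `[n + 1, ∞)`; the subtraction
of `ℝ≥0` is truncated at `0`. -/
def cutoff (n : ℕ) (x : ℝ≥0) : ℝ≥0 := min 1 (n + 1 - x)

theorem cutoff_le_one (n : ℕ) (x : ℝ≥0) : cutoff n x ≤ 1 := min_le_left _ _

theorem cutoff_eq_one {n : ℕ} {x : ℝ≥0} (h : x ≤ n) : cutoff n x = 1 :=
  min_eq_left (le_tsub_of_add_le_left (by gcongr))

theorem monotone_cutoff (x : ℝ≥0) : Monotone fun n => cutoff n x := fun _ _ hmn =>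
  min_le_min le_rfl (tsub_le_tsub_right (by gcongr) x)

/-- The function `x ^ k` on `[0, ∞)`, cut off to have compact support. -/
def cutoffPow (k n : ℕ) : C_c(ℝ≥0, ℝ) where
  toFun x := (x ^ k * cutoff n x : ℝ≥0)
  continuous_toFun := by unfold cutoff; fun_prop
  hasCompactSupport' := HasCompactSupport.of_support_subset_isCompact
    (isCompact_Icc (a := (0 : ℝ≥0)) (b := (n + 1 : ℝ≥0))) fun x hx => by
      refine ⟨zero_le, le_of_not_ge fun hlt => hx ?_⟩
      simp [cutoff, tsub_eq_zero_of_le hlt]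

theorem cutoffPow_apply (k n : ℕ) (x : ℝ≥0) : cutoffPow k n x = (x ^ k * cutoff n x : ℝ≥0) := rfl

theorem cutoffPow_le_pow (k n : ℕ) (x : ℝ≥0) : cutoffPow k n x ≤ (x : ℝ) ^ k := by
  rw [cutoffPow_apply]
  exact_mod_cast mul_le_of_le_one_right zero_le (cutoff_le_one n x)

theorem pow_sub_le_cutoffPow (k : ℕ) {n : ℕ} (hn : 0 < n) (x : ℝ≥0) :
    (x : ℝ) ^ k - (n : ℝ)⁻¹ * (x : ℝ) ^ (k + 1) ≤ cutoffPow k n x := by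
  rw [cutoffPow_apply]
  rcases le_total x n with h | h
  · rw [cutoff_eq_one h, mul_one, NNReal.coe_pow]
    exact sub_le_self _ (by positivity)
  · refine le_trans (sub_nonpos.2 ?_) (NNReal.coe_nonneg _)
    have one_le : 1 ≤ (n : ℝ)⁻¹ * x := by
      rw [inv_mul_eq_div, one_le_div (by exact_mod_cast hn)]
      exact_mod_cast h
    calc (x : ℝ) ^ k ≤ (n : ℝ)⁻¹ * x * x ^ k := le_mul_of_one_le_left (by positivity) one_le
      _ = (n : ℝ)⁻¹ * x ^ (k + 1) := by ring

theorem lintegral_pow_eq_of_tendsto {μ : Measure ℝ≥0} {k : ℕ} {c : ℝ}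
    (hint : ∀ n, Integrable (cutoffPow k n) μ)
    (hlim : Tendsto (fun n => ∫ x, cutoffPow k n x ∂μ) atTop (𝓝 c)) :
    ∫⁻ x : ℝ≥0, ENNReal.ofReal ((x : ℝ) ^ k) ∂μ = ENNReal.ofReal c := by
  have monotone_limit : Tendsto (fun n => ∫⁻ x : ℝ≥0, ENNReal.ofReal (cutoffPow k n x) ∂μ) atTop
      (𝓝 (∫⁻ x : ℝ≥0, ENNReal.ofReal ((x : ℝ) ^ k) ∂μ)) := by
    refine lintegral_tendsto_of_tendsto_of_monotone
      (fun n => (cutoffPow k n).continuous.measurable.ennreal_ofReal.aemeasurable)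
      (.of_forall fun x m n hmn => ENNReal.ofReal_le_ofReal ?_) (.of_forall fun x => ?_)
    · exact NNReal.coe_le_coe.2 (mul_le_mul_right (monotone_cutoff x hmn) _)
    · refine tendsto_const_nhds.congr' ?_
      obtain ⟨N, hN⟩ := exists_nat_ge x
      filter_upwards [eventually_ge_atTop N] with n hn
      rw [cutoffPow_apply, cutoff_eq_one (hN.trans (by exact_mod_cast hn)), mul_one,
        NNReal.coe_pow]
  refine tendsto_nhds_unique monotone_limit ((ENNReal.tendsto_ofReal hlim).congr fun n => ?_)
  exact ofReal_integral_eq_lintegral_ofReal (hint n) (.of_forall fun x => NNReal.coe_nonneg _)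

theorem isSM_of_lintegral_pow_eq {μ : Measure ℝ≥0} {a : ℕ → ℝ} (ha : ∀ k, 0 ≤ a k)
    (h : ∀ k, ∫⁻ x : ℝ≥0, ENNReal.ofReal ((x : ℝ) ^ k) ∂μ = ENNReal.ofReal (a k)) : IsSM a := by
  have pow_nonneg' (k : ℕ) : ∀ᵐ x : ℝ≥0 ∂μ, 0 ≤ (x : ℝ) ^ k :=
    .of_forall fun x => pow_nonneg x.2 k
  have measurable_pow' (k : ℕ) : Measurable fun x : ℝ≥0 => (x : ℝ) ^ k := by fun_prop
  have measurable_coe : Measurable ((↑) : ℝ≥0 → ℝ) := measurable_coe_nnreal_real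
  refine ⟨μ.map (↑), ?_, fun k => ⟨?_, ?_⟩⟩
  · rw [Measure.map_apply measurable_coe measurableSet_Iio]
    convert measure_empty (μ := μ)
    ext x
    simp
  · refine (integrable_map_measure (by fun_prop) measurable_coe.aemeasurable).2
      ⟨(measurable_pow' k).aestronglyMeasurable, ?_⟩
    change HasFiniteIntegral (fun x : ℝ≥0 => (x : ℝ) ^ k) μ
    rw [hasFiniteIntegral_iff_ofReal (pow_nonneg' k)]
    exact (h k).trans_lt ENNReal.ofReal_lt_top
  · rw [integral_map measurable_coe.aemeasurable (by fun_prop),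
      integral_eq_lintegral_of_nonneg_ae (pow_nonneg' k) (measurable_pow' k).aestronglyMeasurable,
      h, ENNReal.toReal_ofReal (ha k)]

theorem isSM_of_map_nonneg (L : Polynomial ℝ →ₗ[ℝ] ℝ)
    (hL : ∀ p : Polynomial ℝ, (∀ x, 0 ≤ x → 0 ≤ p.eval x) → 0 ≤ L p) :
    IsSM fun n => L (Polynomial.X ^ n) := by
  obtain ⟨Λ, hΛ⟩ := exists_positiveLinearMap_of_map_nonneg L hL
  have upper (k n : ℕ) : Λ (cutoffPow k n) ≤ L (Polynomial.X ^ k) :=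
    (hΛ _ _).1 fun x => by simpa using cutoffPow_le_pow k n x
  have lower (k : ℕ) {n : ℕ} (hn : 0 < n) :
      L (Polynomial.X ^ k) - L (Polynomial.X ^ (k + 1)) / n ≤ Λ (cutoffPow k n) := by
    have := (hΛ (Polynomial.X ^ k - (n : ℝ)⁻¹ • Polynomial.X ^ (k + 1)) (cutoffPow k n)).2
      fun x => by simpa using pow_sub_le_cutoffPow k hn x
    rwa [map_sub, map_smul, smul_eq_mul, inv_mul_eq_div] at this
  have lim (k : ℕ) : Tendsto (fun n => Λ (cutoffPow k n)) atTop (𝓝 (L (Polynomial.X ^ k))) := by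
    refine tendsto_of_tendsto_of_tendsto_of_le_of_le' ?_ tendsto_const_nhds
      ((eventually_gt_atTop 0).mono fun n hn => lower k hn) (.of_forall (upper k))
    simpa using tendsto_const_nhds.sub
      (tendsto_const_div_atTop_nhds_zero_nat (L (Polynomial.X ^ (k + 1))))
  refine isSM_of_lintegral_pow_eq (μ := RealRMK.rieszMeasure Λ)
    (fun k => hL _ fun x hx => by simpa using pow_nonneg hx k)
    fun k => lintegral_pow_eq_of_tendsto (fun n => ?_) ?_
  · exact (cutoffPow k n).continuous.integrable_of_hasCompactSupport
      (cutoffPow k n).hasCompactSupport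
  · simpa only [RealRMK.integral_rieszMeasure] using lim k

/-- The Riesz functional of a sequence: the linear functional `Xⁿ ↦ a n` on polynomials. -/
noncomputable def rieszFunctional (a : ℕ → ℝ) : Polynomial ℝ →ₗ[ℝ] ℝ :=
  (Polynomial.basisMonomials ℝ).constr ℝ a

theorem rieszFunctional_X_pow (a : ℕ → ℝ) (n : ℕ) :
    rieszFunctional a (Polynomial.X ^ n) = a n := by
  have := (Polynomial.basisMonomials ℝ).constr_basis ℝ a n
  rw [Polynomial.coe_basisMonomials] at this
  rw [← Polynomial.monomial_one_right_eq_X_pow]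
  exact this

theorem rieszFunctional_eq_sum (a : ℕ → ℝ) (p : Polynomial ℝ) :
    rieszFunctional a p = ∑ k ∈ range (p.natDegree + 1), p.coeff k * a k := by
  conv_lhs => rw [p.as_sum_range_C_mul_X_pow]
  simp only [map_sum, ← Polynomial.smul_eq_C_mul, map_smul, rieszFunctional_X_pow, smul_eq_mul]

theorem rieszFunctional_eq_integral {a : ℕ → ℝ} {μ : Measure ℝ}
    (hμ : ∀ k : ℕ, Integrable (fun x : ℝ => x ^ k) μ ∧ a k = ∫ x, x ^ k ∂μ) (p : Polynomial ℝ) :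
    rieszFunctional a p = ∫ x, p.eval x ∂μ := by
  simp_rw [rieszFunctional_eq_sum, Polynomial.eval_eq_sum_range]
  rw [integral_finsetSum _ fun k _ => (hμ k).1.const_mul _]
  simp_rw [integral_const_mul, (hμ _).2]

/-- **Haviland's theorem** on `[0, ∞)`. -/
theorem isSM_iff_rieszFunctional_nonneg {a : ℕ → ℝ} :
    IsSM a ↔ ∀ p : Polynomial ℝ, (∀ x, 0 ≤ x → 0 ≤ p.eval x) → 0 ≤ rieszFunctional a p := by
  refine ⟨fun ⟨μ, hμ0, hμ⟩ p hp => ?_, fun h => ?_⟩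
  · rw [rieszFunctional_eq_integral hμ]
    refine integral_nonneg_of_ae ?_
    filter_upwards [measure_eq_zero_iff_ae_notMem.1 hμ0] with x hx
    exact hp x (not_lt.1 hx)
  · simpa only [rieszFunctional_X_pow] using isSM_of_map_nonneg _ h

theorem charpoly_eval_neg_eq_sum_minors {n R : Type*} [Fintype n] [DecidableEq n] [CommRing R]
    (A : Matrix n n R) (x : R) :
    A.charpoly.eval (-x) = (-1) ^ Fintype.card n * ∑ k ∈ range (Fintype.card n + 1),
      (∑ s ∈ univ.powersetCard k, (A.submatrix (Subtype.val : s → n) (Subtype.val : s → n)).det) *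
        x ^ (Fintype.card n - k) := by
  cases subsingleton_or_nontrivial R
  · exact Subsingleton.elim _ _
  rw [Polynomial.eval_eq_sum_range, A.charpoly_natDegree_eq_dim, ← sum_range_reflect, mul_sum]
  refine sum_congr rfl fun k hk => ?_
  have hk' : k ≤ Fintype.card n := Nat.lt_succ_iff.1 (mem_range.1 hk)
  rw [Nat.add_sub_cancel, Matrix.charpoly_coeff_eq_sum_minors A k hk', neg_pow x]
  have sign : (-1 : R) ^ Fintype.card n = (-1) ^ k * (-1) ^ (Fintype.card n - k) := by
    rw [← pow_add, Nat.add_sub_cancel' hk']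
  rw [sign]
  ring

theorem posSemidef_of_principalMinors_nonneg {n : Type*} [Finite n] [DecidableEq n]
    {A : Matrix n n ℝ} (hA : A.IsHermitian)
    (h : ∀ s : Finset n, 0 ≤ (A.submatrix (Subtype.val : s → n) (Subtype.val : s → n)).det) :
    A.PosSemidef := by
  cases nonempty_fintype n
  rw [hA.posSemidef_iff_eigenvalues_nonneg]
  intro i
  by_contra hneg
  have pos : 0 < -hA.eigenvalues i := neg_pos.2 (not_le.1 hneg)
  have root : A.charpoly.eval (- -hA.eigenvalues i) = 0 := by
    rw [neg_neg]
    exact Matrix.mem_spectrum_iff_isRoot_charpoly.1 (hA.eigenvalues_mem_spectrum_real i)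
  rw [charpoly_eval_neg_eq_sum_minors] at root
  refine (mul_ne_zero (pow_ne_zero _ (by norm_num)) (ne_of_gt ?_)) root
  rw [sum_range_succ']
  refine add_pos_of_nonneg_of_pos (sum_nonneg fun k _ => mul_nonneg
    (sum_nonneg fun s _ => h s) (pow_nonneg pos.le _)) ?_
  simpa using pow_pos pos _

theorem TP.sum_mul_mul_nonneg {M : ℕ → ℕ → ℝ} (h : TP (Subsemiring.nonneg ℝ) M)
    (hsymm : ∀ i j, M i j = M j i) (n : ℕ) (v : ℕ → ℝ) :
    0 ≤ ∑ i ∈ range n, ∑ j ∈ range n, v i * v j * M i j := by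
  have posSemidef : (Matrix.of fun i j : Fin n => M i j).PosSemidef := by
    refine posSemidef_of_principalMinors_nonneg (by ext i j; simp [hsymm]) fun s => ?_
    rw [← Matrix.det_submatrix_equiv_self (s.orderIsoOfFin rfl).toEquiv]
    exact h s.card (fun i => s.orderEmbOfFin rfl i) (fun i => s.orderEmbOfFin rfl i)
      (fun i j hij => by simpa using hij) fun i j hij => by simpa using hij
  have := posSemidef.dotProduct_mulVec_nonneg fun i => v i
  simp only [dotProduct, Matrix.mulVec, star_trivial, Matrix.of_apply, mul_sum] at this
  simpa only [sum_range, mul_comm (M _ _), ← mul_assoc] using this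

theorem TP.rieszFunctional_X_pow_mul_sq_nonneg {a : ℕ → ℝ}
    (h : TP (Subsemiring.nonneg ℝ) fun i j => a (i + j)) (b : ℕ) (s : Polynomial ℝ) :
    0 ≤ rieszFunctional a (Polynomial.X ^ b * s ^ 2) := by
  have shifted : TP (Subsemiring.nonneg ℝ) fun i j => a (b + i + j) :=
    h.submatrix (fun _ _ hij => Nat.add_lt_add_left hij b) strictMono_id
  have quadratic_form : rieszFunctional a (Polynomial.X ^ b * s ^ 2) =
      ∑ i ∈ range (s.natDegree + 1), ∑ j ∈ range (s.natDegree + 1),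
        s.coeff i * s.coeff j * a (b + i + j) := by
    conv_lhs => rw [pow_two, s.as_sum_range_C_mul_X_pow, sum_mul_sum, mul_sum, map_sum]
    refine sum_congr rfl fun i _ => ?_
    rw [mul_sum, map_sum]
    refine sum_congr rfl fun j _ => ?_
    rw [← rieszFunctional_X_pow a, ← smul_eq_mul (s.coeff i * s.coeff j), ← map_smul,
      Polynomial.smul_eq_C_mul, Polynomial.C_mul]
    congr 1
    ring
  rw [quadratic_form]
  exact shifted.sum_mul_mul_nonneg (fun i j => by rw [add_right_comm]) _ _

/-- **Stieltjes' theorem**, for Hankel matrices that are totally positive. -/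
theorem TP.isSM {a : ℕ → ℝ} (h : TP (Subsemiring.nonneg ℝ) fun i j => a (i + j)) : IsSM a :=
  isSM_iff_rieszFunctional_nonneg.2 fun _ hp => map_nonneg_of_sq_nonneg hp
    (fun s => by simpa using h.rieszFunctional_X_pow_mul_sq_nonneg 0 s)
    fun s => by simpa using h.rieszFunctional_X_pow_mul_sq_nonneg 1 s

/-! ### Operations on Stieltjes moment sequences -/

theorem IsSM.pow {s : ℝ} (hs : 0 ≤ s) : IsSM fun n => s ^ n := by
  refine ⟨Measure.dirac s, ?_, fun k => ⟨integrable_dirac (by simp), by simp⟩⟩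
  rw [Measure.dirac_apply' _ measurableSet_Iio]
  simp [hs]

theorem IsSM.sum_mul {x : ℕ → ℝ} (hx : IsSM x) {I : ℕ → Finset ℕ} {c : ℕ → ℕ → ℝ}
    (hc : ∀ s : ℝ, 0 ≤ s → IsSM fun n => ∑ k ∈ I n, c n k * s ^ k) :
    IsSM fun n => ∑ k ∈ I n, c n k * x k := by
  obtain ⟨μ, hμ0, hμ⟩ := hx
  refine isSM_iff_rieszFunctional_nonneg.2 fun p hp => ?_
  have integrable (n : ℕ) : Integrable (fun s => ∑ k ∈ I n, c n k * s ^ k) μ :=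
    integrable_finsetSum _ fun k _ => (hμ k).1.const_mul _
  have mixture : rieszFunctional (fun n => ∑ k ∈ I n, c n k * x k) p =
      ∫ s, rieszFunctional (fun n => ∑ k ∈ I n, c n k * s ^ k) p ∂μ := by
    simp_rw [rieszFunctional_eq_sum]
    rw [integral_finsetSum _ fun n _ => (integrable n).const_mul _]
    refine sum_congr rfl fun n _ => ?_
    rw [integral_const_mul, integral_finsetSum _ fun k _ => (hμ k).1.const_mul _]
    simp_rw [integral_const_mul, (hμ _).2]
  rw [mixture]
  refine integral_nonneg_of_ae ?_
  filter_upwards [measure_eq_zero_iff_ae_notMem.1 hμ0] with s hs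
  exact isSM_iff_rieszFunctional_nonneg.1 (hc s (not_lt.1 hs)) p hp

theorem IsSM.mul {x y : ℕ → ℝ} (hx : IsSM x) (hy : IsSM y) : IsSM fun n => x n * y n := by
  have mul_pow_isSM (s : ℝ) (hs : 0 ≤ s) : IsSM fun n => x n * s ^ n := by
    simpa [mul_comm] using hx.sum_mul (I := fun n => {n}) (c := fun n _ => s ^ n)
      fun t ht => by simpa [mul_pow] using IsSM.pow (mul_nonneg hs ht)
  simpa using hy.sum_mul (I := fun n => {n}) (c := fun n _ => x n)
    fun s hs => by simpa using mul_pow_isSM s hs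

theorem convolutionPreservesSM_of_isSM {A : ℕ → ℕ → ℝ}
    (hA : ∀ s t : ℝ, 0 ≤ s → 0 ≤ t →
      IsSM fun n => ∑ k ∈ range (n + 1), A n k * s ^ k * t ^ (n - k)) :
    ConvolutionPreservesSM A := by
  intro x y hx hy
  have reflected (c : ℕ → ℕ → ℝ) (n : ℕ) : ∑ k ∈ range (n + 1), c k (n - k) =
      ∑ k ∈ range (n + 1), c (n - k) k := by
    rw [← sum_range_reflect]
    refine sum_congr rfl fun k hk => ?_
    rw [Nat.add_sub_cancel, Nat.sub_sub_self (Nat.lt_succ_iff.1 (mem_range.1 hk))]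
  have pow_left (s : ℝ) (hs : 0 ≤ s) :
      IsSM fun n => ∑ k ∈ range (n + 1), A n k * s ^ k * y (n - k) := by
    simp_rw [fun n => reflected (fun k l => A n k * s ^ k * y l) n]
    refine hy.sum_mul fun t ht => ?_
    simp_rw [fun n => (reflected (fun k l => A n k * s ^ k * t ^ l) n).symm]
    exact hA s t hs ht
  have := hx.sum_mul (I := fun n => range (n + 1)) (c := fun n k => A n k * y (n - k))
    fun s hs => by simpa only [mul_right_comm] using pow_left s hs
  simpa only [mul_right_comm] using this

theorem isSM_factorial : IsSM fun n => (n.factorial : ℝ) := by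
  let density (x : ℝ) : ℝ≥0 := Real.toNNReal (Real.exp (-x))
  have density_smul (x y : ℝ) : density x • y = Real.exp (-x) * y := by
    rw [NNReal.smul_def, Real.coe_toNNReal _ (Real.exp_pos _).le, smul_eq_mul]
  have measurable_density : Measurable density := by fun_prop
  refine ⟨(volume.restrict (Set.Ioi 0)).withDensity fun x => density x, ?_, fun k => ⟨?_, ?_⟩⟩
  · refine withDensity_absolutelyContinuous _ _ ?_
    rw [Measure.restrict_apply measurableSet_Iio, Set.Iio_inter_Ioi, Set.Ioo_self, measure_empty]
  · rw [integrable_withDensity_iff_integrable_smul measurable_density]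
    simp_rw [density_smul]
    refine IntegrableOn.congr_fun
      (Real.GammaIntegral_convergent (s := k + 1) (by positivity)) (fun x _ => ?_) measurableSet_Ioi
    simp
  · change (k.factorial : ℝ) = _
    rw [integral_withDensity_eq_integral_smul measurable_density, ← Real.Gamma_nat_eq_factorial,
      Real.Gamma_eq_integral (by positivity)]
    refine setIntegral_congr_fun measurableSet_Ioi fun x _ => ?_
    simp [density_smul]

end Stieltjes

/-! ### Exponential Riordan arrays -/

section Series

variable {A : Type*} [CommRing A] {F : A⟦X⟧}

theorem coeff_mul_pow_eq_zero (hF : constantCoeff F = 0) (G : A⟦X⟧) {n k : ℕ} (h : n < k) :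
    coeff n (G * F ^ k) = 0 :=
  X_pow_dvd_iff.1 ((pow_dvd_pow_of_dvd (X_dvd_iff.2 hF) k).mul_left G) n h

theorem coeff_pow_eq_zero (hF : constantCoeff F = 0) {n k : ℕ} (h : n < k) :
    coeff n (F ^ k) = 0 := by
  simpa using coeff_mul_pow_eq_zero hF 1 h

theorem coeff_subst_eq_sum (hF : constantCoeff F = 0) (H : A⟦X⟧) {n N : ℕ} (hN : n < N) :
    coeff n (H.subst F) = ∑ k ∈ range N, coeff k H * coeff n (F ^ k) := by
  rw [coeff_subst' (HasSubst.of_constantCoeff_zero' hF)]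
  refine finsum_eq_sum_of_support_subset _ fun k hk => ?_
  contrapose! hk
  have hnk : n < k := hN.trans_le (by simpa using hk)
  simp [coeff_pow_eq_zero hF hnk]

theorem coeff_mul_subst_eq_sum (hF : constantCoeff F = 0) (G H : A⟦X⟧) {n N : ℕ} (hN : n < N) :
    coeff n (G * H.subst F) = ∑ k ∈ range N, coeff k H * coeff n (G * F ^ k) := by
  simp_rw [coeff_mul, mul_sum]
  rw [sum_comm]
  refine sum_congr rfl fun x hx => ?_
  have hx2 : x.2 < N := by
    have := Finset.HasAntidiagonal.mem_antidiagonal.1 hx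
    omega
  rw [coeff_subst_eq_sum hF H hx2, mul_sum]
  exact sum_congr rfl fun k _ => mul_left_comm _ _ _

theorem constantCoeff_C_mul (hF : constantCoeff F = 0) (c : A) : constantCoeff (C c * F) = 0 := by
  simp [hF]

theorem constantCoeff_map_eq_zero {B : Type*} [CommRing B] (φ : A →+* B)
    (hF : constantCoeff F = 0) : constantCoeff (PowerSeries.map φ F) = 0 := by
  rw [← coeff_zero_eq_constantCoeff_apply, coeff_map, coeff_zero_eq_constantCoeff_apply, hF,
    map_zero]

variable [Algebra ℚ A]

/-- The inverse factorial `1 / k!` in a `ℚ`-algebra. -/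
noncomputable def invFact (A : Type*) [CommRing A] [Algebra ℚ A] (k : ℕ) : A :=
  algebraMap ℚ A (1 / k.factorial)

theorem factorial_mul_invFact (k : ℕ) : (k.factorial : A) * invFact A k = 1 := by
  rw [invFact, ← map_natCast (algebraMap ℚ A), ← map_mul,
    mul_one_div_cancel (by exact_mod_cast k.factorial_ne_zero), map_one]

theorem succ_mul_invFact (k : ℕ) : ((k + 1 : ℕ) : A) * invFact A (k + 1) = invFact A k := by
  have fact_succ := factorial_mul_invFact (A := A) (k + 1)
  rw [Nat.factorial_succ] at fact_succ
  push_cast at fact_succ ⊢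
  linear_combination invFact A k * fact_succ -
    ((k + 1) * invFact A (k + 1)) * factorial_mul_invFact (A := A) k

theorem invFact_zero : invFact A 0 = 1 := by simp [invFact]

theorem map_invFact {B : Type*} [CommRing B] [Algebra ℚ B] (φ : A →+* B) (k : ℕ) :
    φ (invFact A k) = invFact B k :=
  RingHom.congr_fun (Subsingleton.elim (φ.comp (algebraMap ℚ A)) (algebraMap ℚ B)) _

theorem expMul_eq_subst_rescale (hF : constantCoeff F = 0) (c : A) :
    expMul c F = (rescale c (exp A)).subst F := by
  ext n
  rw [expMul, coeff_subst_eq_sum (constantCoeff_C_mul hF c) _ (Nat.lt_succ_self n),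
    coeff_subst_eq_sum hF _ (Nat.lt_succ_self n)]
  refine sum_congr rfl fun k _ => ?_
  rw [mul_pow, ← map_pow, coeff_C_mul, coeff_rescale]
  ring

theorem coeff_mul_expMul (hF : constantCoeff F = 0) (G : A⟦X⟧) (c : A) (n : ℕ) :
    coeff n (G * expMul c F) =
      ∑ k ∈ range (n + 1), invFact A k * c ^ k * coeff n (G * F ^ k) := by
  rw [expMul_eq_subst_rescale hF, coeff_mul_subst_eq_sum hF _ _ (Nat.lt_succ_self n)]
  simp only [coeff_rescale, coeff_exp, invFact, mul_comm (c ^ _)]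

theorem coeff_expMul (hF : constantCoeff F = 0) (c : A) (n : ℕ) :
    coeff n (expMul c F) = ∑ k ∈ range (n + 1), invFact A k * c ^ k * coeff n (F ^ k) := by
  simpa only [one_mul] using coeff_mul_expMul hF 1 c n

theorem constantCoeff_expMul (hF : constantCoeff F = 0) (c : A) :
    constantCoeff (expMul c F) = 1 := by
  rw [← coeff_zero_eq_constantCoeff_apply, coeff_expMul hF]
  simp [invFact_zero]

theorem derivative_expMul (hF : constantCoeff F = 0) (c : A) :
    derivative A (expMul c F) = C c * derivative A F * expMul c F := by
  rw [expMul, derivative_subst (HasSubst.of_constantCoeff_zero' (constantCoeff_C_mul hF c)),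
    derivative_exp, Derivation.leibniz, derivative_C, smul_zero, add_zero, smul_eq_mul]
  ring

theorem expMul_mul_expMul (hF : constantCoeff F = 0) (c d : A) :
    expMul c F * expMul d F = expMul (c + d) F := by
  simp_rw [expMul_eq_subst_rescale hF]
  rw [← subst_mul (HasSubst.of_constantCoeff_zero' hF), exp_mul_exp_eq_exp_add]

theorem expMul_zero (hF : constantCoeff F = 0) : expMul 0 F = 1 := by
  ext n
  rw [coeff_expMul hF, sum_eq_single 0 (fun k _ hk => by simp [hk]) (by simp)]
  simp [invFact_zero]

theorem map_expMul {B : Type*} [CommRing B] [Algebra ℚ B] (φ : A →+* B)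
    (hF : constantCoeff F = 0) (c : A) :
    PowerSeries.map φ (expMul c F) = expMul (φ c) (PowerSeries.map φ F) := by
  ext n
  rw [coeff_map, coeff_expMul hF, coeff_expMul (constantCoeff_map_eq_zero φ hF)]
  simp only [map_sum, map_mul, map_pow, map_invFact, ← coeff_map]

theorem shefferPoly_eq_sum (hF : constantCoeff F = 0) (G : A⟦X⟧) (n : ℕ) :
    shefferPoly F G n = ∑ k ∈ range (n + 1),
      Polynomial.C (n.factorial * invFact A k * coeff n (G * F ^ k)) * Polynomial.X ^ k := by
  rw [shefferPoly, coeff_mul_expMul (constantCoeff_map_eq_zero _ hF), nsmul_eq_mul, mul_sum]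
  refine sum_congr rfl fun k _ => ?_
  simp only [← map_pow (PowerSeries.map _), ← map_mul (PowerSeries.map _), coeff_map,
    Polynomial.C_mul, map_invFact, map_natCast]
  ring

theorem sheffer_eq (hF : constantCoeff F = 0) (G : A⟦X⟧) (n k : ℕ) :
    sheffer F G n k = n.factorial * invFact A k * coeff n (G * F ^ k) := by
  simp_rw [sheffer, shefferPoly_eq_sum hF, Polynomial.finsetSum_coeff,
    Polynomial.coeff_C_mul_X_pow]
  rw [sum_ite_eq, ite_eq_left_iff, mem_range]
  intro hnk
  rw [coeff_mul_pow_eq_zero hF G (by omega), mul_zero]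

theorem sheffer_one_eq (hF : constantCoeff F = 0) (n k : ℕ) :
    sheffer F 1 n k = n.factorial * invFact A k * coeff n (F ^ k) := by
  rw [sheffer_eq hF, one_mul]

theorem sheffer_of_lt (hF : constantCoeff F = 0) (G : A⟦X⟧) {n k : ℕ} (h : n < k) :
    sheffer F G n k = 0 := by
  rw [sheffer_eq hF, coeff_mul_pow_eq_zero hF G h, mul_zero]

theorem sheffer_self (hF : constantCoeff F = 0) (G : A⟦X⟧) (n : ℕ) :
    sheffer F G n n = constantCoeff G * coeff 1 F ^ n := by
  obtain ⟨H, rfl⟩ := X_dvd_iff.2 hF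
  rw [sheffer_eq hF, factorial_mul_invFact, one_mul, mul_pow]
  simp [mul_left_comm G, coeff_X_pow_mul']

theorem sheffer_zero_zero (hF : constantCoeff F = 0) (G : A⟦X⟧) :
    sheffer F G 0 0 = constantCoeff G := by
  rw [sheffer_self hF, pow_zero, mul_one]

theorem sheffer_X (Φ : A⟦X⟧) (n k : ℕ) :
    sheffer X Φ n k = n.factorial * invFact A k * if k ≤ n then coeff (n - k) Φ else 0 := by
  rw [sheffer_eq constantCoeff_X, coeff_mul_X_pow']

theorem sheffer_X_one (n k : ℕ) : sheffer (X : A⟦X⟧) 1 n k = if n = k then 1 else 0 := by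
  rw [sheffer_one_eq constantCoeff_X, coeff_X_pow]
  split_ifs with h
  · rw [h, factorial_mul_invFact, one_mul]
  · rw [mul_zero]

theorem map_sheffer_one {B : Type*} [CommRing B] [Algebra ℚ B] (ψ : A →+* B)
    (hF : constantCoeff F = 0) (n k : ℕ) :
    sheffer (PowerSeries.map ψ F) 1 n k = ψ (sheffer F 1 n k) := by
  rw [sheffer_one_eq hF, sheffer_one_eq (constantCoeff_map_eq_zero ψ hF), map_mul, map_mul,
    map_natCast, map_invFact, ← map_pow, coeff_map]

/-- The multiplication law of the exponential Riordan group. -/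
theorem isProd_sheffer_sheffer (hF : constantCoeff F = 0) {G : A⟦X⟧} (hG : constantCoeff G = 0)
    (E H : A⟦X⟧) :
    IsProd (sheffer F E) (sheffer G H) (sheffer (G.subst F) (E * H.subst F)) := by
  have hGF : constantCoeff (G.subst F) = 0 := by
    rw [← coeff_zero_eq_constantCoeff_apply, coeff_subst_eq_sum hF G Nat.zero_lt_one]
    simp [hG]
  refine .of_eq_sum (fun n _ => n + 1) (fun n k => ?_)
    fun n k l hl => by rw [sheffer_of_lt hF E hl, zero_mul]
  have hs : HasSubst F := .of_constantCoeff_zero' hF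
  rw [sheffer_eq hGF, mul_assoc E, ← subst_pow hs, ← subst_mul hs,
    coeff_mul_subst_eq_sum hF _ _ (Nat.lt_succ_self n), mul_sum]
  refine sum_congr rfl fun l _ => ?_
  rw [sheffer_eq hF, sheffer_eq hG]
  linear_combination -(n.factorial * invFact A k * coeff l (H * G ^ k) * coeff n (E * F ^ l)) *
    factorial_mul_invFact (A := A) l

theorem sheffer_succ (hF : constantCoeff F = 0) {E : A⟦X⟧} {c : A}
    (hE : derivative A E = C c * derivative A F * E) (n k : ℕ) :
    sheffer F E (n + 1) k = c * sheffer F (E * derivative A F) n k +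
      if k = 0 then 0 else sheffer F (E * derivative A F) n (k - 1) := by
  have sheffer_eq_derivative : sheffer F E (n + 1) k =
      n.factorial * invFact A k * coeff n (derivative A (E * F ^ k)) := by
    rw [coeff_derivative, sheffer_eq hF, Nat.factorial_succ]
    push_cast
    ring
  have leibniz : derivative A (E * F ^ k) = C c * (E * derivative A F * F ^ k) +
      C (k : A) * (E * derivative A F * F ^ (k - 1)) := by
    rw [Derivation.leibniz, derivative_pow, hE, map_natCast, smul_eq_mul, smul_eq_mul]
    ring
  rw [sheffer_eq_derivative, leibniz, map_add, coeff_C_mul, coeff_C_mul]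
  rcases k with _ | k
  · simp [sheffer_eq hF, mul_left_comm c]
  · rw [if_neg k.succ_ne_zero, Nat.add_sub_cancel, sheffer_eq hF, sheffer_eq hF,
      ← succ_mul_invFact k]
    ring

end Series

/-! ### Total positivity of exponential Riordan arrays -/

section Flow

variable {A : Type*} [CommRing A] [Algebra ℚ A] {D : Subsemiring A} {F Φ E : A⟦X⟧} {c : A}

theorem isProd_sheffer_derivative (hF : constantCoeff F = 0) (hΦ : derivative A F = Φ.subst F)
    (E : A⟦X⟧) : IsProd (sheffer F E) (sheffer X Φ) (sheffer F (E * derivative A F)) := by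
  simpa only [subst_X (HasSubst.of_constantCoeff_zero' hF), hΦ] using
    isProd_sheffer_sheffer hF constantCoeff_X E Φ

theorem isProd_sheffer_succ (hF : constantCoeff F = 0)
    (hE : derivative A E = C c * derivative A F * E) :
    IsProd (sheffer F (E * derivative A F)) (upperBidiag c) fun n k => sheffer F E (n + 1) k := by
  simpa only [sheffer_succ hF hE] using isProd_upperBidiag_right c _

/-- The production matrix of `sheffer F E`, when `F' = Φ(F)` and `E' = c F' E`. -/
noncomputable def prodMatrix (c : A) (Φ : A⟦X⟧) (i j : ℕ) : A :=
  c * sheffer X Φ i j + if j = 0 then 0 else sheffer X Φ i (j - 1)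

/-- The production matrix of `sheffer F (E * F')`, when `F' = Φ(F)` and `E' = c F' E`. -/
noncomputable def prodMatrixDerivative (c : A) (Φ : A⟦X⟧) (i j : ℕ) : A :=
  c * sheffer X Φ i j + sheffer X Φ (i + 1) j

theorem isProd_prodMatrix (hF : constantCoeff F = 0) (hΦ : derivative A F = Φ.subst F)
    (hE : derivative A E = C c * derivative A F * E) :
    IsProd (sheffer F E) (prodMatrix c Φ) fun n k => sheffer F E (n + 1) k :=
  (isProd_sheffer_derivative hF hΦ E).assoc (isProd_upperBidiag_right c _)
    (isProd_sheffer_succ hF hE) (· + 1) fun _ _ h => sheffer_of_lt hF E h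

theorem isProd_prodMatrixDerivative (hF : constantCoeff F = 0)
    (hΦ : derivative A F = Φ.subst F) (hE : derivative A E = C c * derivative A F * E) :
    IsProd (sheffer F (E * derivative A F)) (prodMatrixDerivative c Φ)
      fun n k => sheffer F (E * derivative A F) (n + 1) k :=
  (isProd_sheffer_succ hF hE).assoc (isProd_upperBidiag_left c _)
    (fun n k => isProd_sheffer_derivative hF hΦ E (n + 1) k) (· + 1)
    fun _ _ h => sheffer_of_lt hF _ h

theorem prodMatrix_of_succ_lt (c : A) (Φ : A⟦X⟧) {i j : ℕ} (h : i + 1 < j) :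
    prodMatrix c Φ i j = 0 := by
  rw [prodMatrix, sheffer_of_lt constantCoeff_X Φ (by omega),
    sheffer_of_lt constantCoeff_X Φ (by omega), mul_zero, ite_self, add_zero]

theorem prodMatrixDerivative_of_succ_lt (c : A) (Φ : A⟦X⟧) {i j : ℕ} (h : i + 1 < j) :
    prodMatrixDerivative c Φ i j = 0 := by
  rw [prodMatrixDerivative, sheffer_of_lt constantCoeff_X Φ (by omega),
    sheffer_of_lt constantCoeff_X Φ h, mul_zero, add_zero]

theorem TP.prodMatrix (hT : TP D (sheffer X Φ)) (hc : c ∈ D) : TP D (prodMatrix c Φ) :=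
  hT.mul (tp_upperBidiag hc) (isProd_upperBidiag_right c _)

theorem TP.prodMatrixDerivative (hT : TP D (sheffer X Φ)) (hc : c ∈ D) :
    TP D (prodMatrixDerivative c Φ) :=
  TP.mul (tp_upperBidiag hc) hT (isProd_upperBidiag_left c _)

theorem TP.sheffer_of_sheffer_X (hT : TP D (sheffer X Φ)) (hF : constantCoeff F = 0)
    (hΦ : derivative A F = Φ.subst F) (hc : c ∈ D) (hE0 : constantCoeff E ∈ D)
    (hE : derivative A E = C c * derivative A F * E) : TP D (sheffer F E) :=
  .of_production (hT.prodMatrix hc) (by rwa [sheffer_zero_zero hF])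
    (fun j => sheffer_of_lt hF E j.succ_pos) (isProd_prodMatrix hF hΦ hE)

theorem TP.hankel_sheffer (hT : TP D (sheffer X Φ)) (hF : constantCoeff F = 0)
    (hΦ : derivative A F = Φ.subst F) (hc : c ∈ D) (hE0 : constantCoeff E ∈ D)
    (hE : derivative A E = C c * derivative A F * E) :
    TP D fun i j => sheffer F E (i + j) 0 :=
  .hankel_of_production (hT.prodMatrix hc) (fun _ _ => prodMatrix_of_succ_lt c Φ)
    (by rwa [sheffer_zero_zero hF]) (fun _ _ => sheffer_of_lt hF E) (isProd_prodMatrix hF hΦ hE)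

theorem TP.hankel_sheffer_derivative (hT : TP D (sheffer X Φ))
    (hF : constantCoeff F = 0) (hΦ : derivative A F = Φ.subst F) (hc : c ∈ D)
    (hE0 : constantCoeff E ∈ D) (hE : derivative A E = C c * derivative A F * E) :
    TP D fun i j => sheffer F (E * derivative A F) (i + j) 0 := by
  refine .hankel_of_production (hT.prodMatrixDerivative hc)
    (fun _ _ => prodMatrixDerivative_of_succ_lt c Φ) ?_ (fun _ _ => sheffer_of_lt hF _)
    (isProd_prodMatrixDerivative hF hΦ hE)
  rw [(isProd_sheffer_derivative hF hΦ E).eq_sum (n := 1) fun l hl => by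
    rw [sheffer_of_lt hF E hl, zero_mul], sum_range_one, sheffer_zero_zero hF]
  exact mul_mem hE0 (hT.apply_mem 0 0)

end Flow

section Scale

variable {A : Type*} [CommRing A] [Algebra ℝ A]

/-- The series `f(w t) / w`, for `f` with zero constant term. Its Sheffer polynomials homogenize
those of `f`; at `w = 0` it degenerates to the linear part of `f`. -/
noncomputable def scaleSeries (w : A) (f : ℝ⟦X⟧) : A⟦X⟧ :=
  mk fun n => w ^ (n - 1) * algebraMap ℝ A (coeff n f)

variable {f φ : ℝ⟦X⟧}

theorem constantCoeff_scaleSeries (hf : constantCoeff f = 0) (w : A) :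
    constantCoeff (scaleSeries w f) = 0 := by
  rw [← coeff_zero_eq_constantCoeff_apply, scaleSeries, coeff_mk,
    coeff_zero_eq_constantCoeff_apply, hf, map_zero, mul_zero]

theorem scaleSeries_one (f : ℝ⟦X⟧) :
    scaleSeries (1 : A) f = PowerSeries.map (algebraMap ℝ A) f := by
  ext n
  rw [scaleSeries, coeff_mk, one_pow, one_mul, coeff_map]

theorem scaleSeries_X_mul (w : A) (g : ℝ⟦X⟧) :
    scaleSeries w (X * g) = X * rescale w (PowerSeries.map (algebraMap ℝ A) g) := by
  ext n
  rcases n with _ | n <;> simp [scaleSeries, coeff_succ_X_mul]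

theorem coeff_scaleSeries_pow (hf : constantCoeff f = 0) (w : A) (n k : ℕ) :
    coeff n (scaleSeries w f ^ k) = w ^ (n - k) * algebraMap ℝ A (coeff n (f ^ k)) := by
  obtain ⟨g, rfl⟩ := X_dvd_iff.2 hf
  rw [scaleSeries_X_mul, mul_pow, mul_pow, coeff_X_pow_mul', coeff_X_pow_mul']
  split_ifs
  · rw [← map_pow, ← map_pow, coeff_rescale, coeff_map]
  · rw [map_zero, mul_zero]

theorem derivative_scaleSeries (hf : constantCoeff f = 0) (hφ : derivative ℝ f = φ.subst f)
    (w : A) : derivative A (scaleSeries w f) =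
      (rescale w (PowerSeries.map (algebraMap ℝ A) φ)).subst (scaleSeries w f) := by
  ext n
  have coeff_hφ := congrArg (fun g => algebraMap ℝ A (coeff n g)) hφ
  simp only [coeff_derivative, coeff_subst_eq_sum hf φ (Nat.lt_succ_self n), map_sum, map_mul,
    map_add, map_natCast, map_one] at coeff_hφ
  rw [coeff_subst_eq_sum (constantCoeff_scaleSeries hf w) _ (Nat.lt_succ_self n),
    coeff_derivative, scaleSeries, coeff_mk, Nat.add_sub_cancel, mul_assoc, coeff_hφ, mul_sum,
    ← scaleSeries]
  refine sum_congr rfl fun k hk => ?_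
  have hkn : k ≤ n := by simpa [Nat.lt_succ_iff] using hk
  rw [coeff_scaleSeries_pow hf, coeff_rescale, coeff_map, ← pow_mul_pow_sub w hkn]
  ring

theorem derivative_scaleSeries_eq_prod {m : ℕ} {x : Fin m → ℝ} (hf : constantCoeff f = 0)
    (hfx : derivative ℝ f = (∏ i, (1 + C (x i) * X)).subst f) (w : A) :
    derivative A (scaleSeries w f) =
      ∏ i, (1 + C (w * algebraMap ℝ A (x i)) * scaleSeries w f) := by
  have hs : HasSubst (scaleSeries w f) := .of_constantCoeff_zero' (constantCoeff_scaleSeries hf w)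
  have rescale_factor (i) : rescale w (PowerSeries.map (algebraMap ℝ A) (1 + C (x i) * X)) =
      1 + (w * algebraMap ℝ A (x i)) • X := by
    ext n
    simp only [coeff_rescale, coeff_map, map_add, coeff_C_mul, coeff_smul, coeff_one, coeff_X]
    rcases n with _ | _ | n <;> simp
  rw [derivative_scaleSeries hf hfx, ← coe_substAlgHom hs, map_prod, map_prod, map_prod]
  refine prod_congr rfl fun i _ => ?_
  rw [rescale_factor, map_add, map_one, map_smul, substAlgHom_X, smul_eq_C_mul]

variable [Algebra ℚ A]

theorem sheffer_scaleSeries_one (hf : constantCoeff f = 0) (w : A) (n k : ℕ) :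
    sheffer (scaleSeries w f) 1 n k = w ^ (n - k) * algebraMap ℝ A (sheffer f 1 n k) := by
  rw [sheffer_one_eq (constantCoeff_scaleSeries hf w), coeff_scaleSeries_pow hf,
    sheffer_one_eq hf, map_mul, map_mul, map_natCast, map_invFact]
  ring

theorem tp_sheffer_X_rescale {D : Subsemiring A} (hD : ∀ x : ℝ, 0 ≤ x → algebraMap ℝ A x ∈ D)
    (hφ : IsPF φ) {w : A} (hw : w ∈ D) :
    TP D (sheffer X (rescale w (PowerSeries.map (algebraMap ℝ A) φ))) := by
  have toeplitz_tp : TP (Subsemiring.nonneg ℝ) fun i j => if j ≤ i then coeff (i - j) φ else 0 :=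
    hφ
  have scaled_tp := toeplitz_tp.scale (u := fun i => (i.factorial : ℝ)) (v := invFact ℝ)
    (fun i => Subsemiring.mem_nonneg.2 (Nat.cast_nonneg _))
    (fun i => Subsemiring.mem_nonneg.2 (by simp [invFact]))
  have homogenized_tp := (scaled_tp.map (Q := D) (algebraMap ℝ A) hD).scale_pow_sub
    (fun i j hij => by simp [hij.not_ge]) hw
  convert homogenized_tp using 3 with i j
  rw [sheffer_X]
  split_ifs with hij
  · simp only [coeff_rescale, coeff_map, map_mul, map_natCast, map_invFact]
    ring
  · simp

end Scale

section Homogenization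

variable {A : Type*} [CommRing A] [Algebra ℚ A] {F : A⟦X⟧}

theorem sheffer_mul_expMul_zero (hF : constantCoeff F = 0) (G : A⟦X⟧) (c : A) (n : ℕ) :
    sheffer F (G * expMul c F) n 0 = ∑ k ∈ range (n + 1), sheffer F G n k * c ^ k := by
  rw [sheffer_eq hF, pow_zero, mul_one, coeff_mul_expMul hF, invFact_zero, mul_sum]
  refine sum_congr rfl fun k _ => ?_
  rw [sheffer_eq hF]
  ring

theorem sheffer_one_succ_succ (hF : constantCoeff F = 0) (n k : ℕ) :
    sheffer F 1 (n + 1) (k + 1) = sheffer F (derivative A F) n k := by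
  simpa using sheffer_succ hF (E := 1) (c := 0) (by simp) n (k + 1)

theorem shefferPoly_expMul_eq_sum (hF : constantCoeff F = 0) (c : A) (n : ℕ) :
    shefferPoly F (expMul c F) n = ∑ j ∈ range (n + 1),
      Polynomial.C (sheffer F 1 n j) * (Polynomial.X + Polynomial.C c) ^ j := by
  have hF' := constantCoeff_map_eq_zero Polynomial.C hF
  rw [shefferPoly, map_expMul _ hF, expMul_mul_expMul hF', coeff_expMul hF', nsmul_eq_mul, mul_sum,
    add_comm (Polynomial.C c)]
  refine sum_congr rfl fun j _ => ?_
  rw [sheffer_one_eq hF, map_mul, map_mul, map_natCast, map_invFact, ← map_pow, coeff_map]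
  ring

theorem sheffer_expMul_eq_sum (hF : constantCoeff F = 0) (c : A) (n k : ℕ) :
    sheffer F (expMul c F) n k =
      ∑ j ∈ range (n + 1), sheffer F 1 n j * (c ^ (j - k) * j.choose k) := by
  simp only [sheffer, shefferPoly_expMul_eq_sum hF, Polynomial.finsetSum_coeff,
    Polynomial.coeff_C_mul, Polynomial.coeff_X_add_C_pow]

theorem sum_sheffer_expMul {B : Type*} [CommRing B] (ψ : A →+* B) (hF : constantCoeff F = 0)
    (c : A) (s t : B) (n : ℕ) :
    ∑ k ∈ range (n + 1), ψ (sheffer F (expMul c F) n k) * s ^ k * t ^ (n - k) =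
      ∑ j ∈ range (n + 1), ψ (sheffer F 1 n j) * (s + ψ c * t) ^ j * t ^ (n - j) := by
  simp_rw [sheffer_expMul_eq_sum hF, map_sum, sum_mul]
  rw [sum_comm]
  refine sum_congr rfl fun j hj => ?_
  have hjn : j ≤ n := by simpa [Nat.lt_succ_iff] using hj
  rw [add_pow, mul_sum, sum_mul]
  symm
  refine sum_subset_zero_on_sdiff (by simpa using hjn) (fun k hk => ?_) fun k hk => ?_
  · simp only [Finset.mem_sdiff, mem_range, not_lt] at hk
    simp [Nat.choose_eq_zero_of_lt hk.2]
  · have hkj : k ≤ j := by simpa [Nat.lt_succ_iff] using hk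
    rw [show n - k = (j - k) + (n - j) by omega, pow_add, mul_pow]
    simp only [map_mul, map_pow, map_natCast]
    ring

variable [Algebra ℝ A] {D : Subsemiring A} {f φ : ℝ⟦X⟧}

theorem sheffer_scaleSeries_expMul_zero (hf : constantCoeff f = 0) (c w : A) (n : ℕ) :
    sheffer (scaleSeries w f) (expMul c (scaleSeries w f)) n 0 =
      ∑ k ∈ range (n + 1), algebraMap ℝ A (sheffer f 1 n k) * c ^ k * w ^ (n - k) := by
  have homogenized := sheffer_mul_expMul_zero (constantCoeff_scaleSeries hf w) 1 c n
  rw [one_mul] at homogenized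
  refine homogenized.trans (sum_congr rfl fun k _ => ?_)
  rw [sheffer_scaleSeries_one hf]
  ring

theorem tp_hankel_sum_sheffer (hD : ∀ x : ℝ, 0 ≤ x → algebraMap ℝ A x ∈ D)
    (hf : constantCoeff f = 0) (hfφ : derivative ℝ f = φ.subst f) (hφ : IsPF φ) {c w : A}
    (hc : c ∈ D) (hw : w ∈ D) :
    TP D fun i j => ∑ k ∈ range (i + j + 1),
      algebraMap ℝ A (sheffer f 1 (i + j) k) * c ^ k * w ^ (i + j - k) := by
  have hF := constantCoeff_scaleSeries hf w
  have hankel_tp := (tp_sheffer_X_rescale hD hφ hw).hankel_sheffer hF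
    (derivative_scaleSeries hf hfφ w) hc ((constantCoeff_expMul hF c).symm ▸ one_mem D)
    (derivative_expMul hF c)
  simpa only [sheffer_scaleSeries_expMul_zero hf] using hankel_tp

theorem tp_hankel_sum_sheffer_succ (hD : ∀ x : ℝ, 0 ≤ x → algebraMap ℝ A x ∈ D)
    (hf : constantCoeff f = 0) (hfφ : derivative ℝ f = φ.subst f) (hφ : IsPF φ) {c w : A}
    (hc : c ∈ D) (hw : w ∈ D) :
    TP D fun i j => ∑ k ∈ range (i + j + 1),
      algebraMap ℝ A (sheffer f 1 (i + j + 1) (k + 1)) * c ^ k * w ^ (i + j - k) := by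
  have hF := constantCoeff_scaleSeries hf w
  have hankel_tp := (tp_sheffer_X_rescale hD hφ hw).hankel_sheffer_derivative hF
    (derivative_scaleSeries hf hfφ w) hc ((constantCoeff_expMul hF c).symm ▸ one_mem D)
    (derivative_expMul hF c)
  convert hankel_tp using 3 with i j
  rw [mul_comm (expMul c _), sheffer_mul_expMul_zero hF]
  refine sum_congr rfl fun k _ => ?_
  rw [← sheffer_one_succ_succ hF, sheffer_scaleSeries_one hf, Nat.add_sub_add_right]
  ring

theorem tp_sheffer_expMul (hD : ∀ x : ℝ, 0 ≤ x → algebraMap ℝ A x ∈ D)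
    (hf : constantCoeff f = 0) (hfφ : derivative ℝ f = φ.subst f) (hφ : IsPF φ) {c : A}
    (hc : c ∈ D) :
    TP D (sheffer (PowerSeries.map (algebraMap ℝ A) f)
      (expMul c (PowerSeries.map (algebraMap ℝ A) f))) := by
  have hF := constantCoeff_scaleSeries hf (1 : A)
  have sheffer_tp := (tp_sheffer_X_rescale hD hφ (one_mem D)).sheffer_of_sheffer_X hF
    (derivative_scaleSeries hf hfφ 1) hc ((constantCoeff_expMul hF c).symm ▸ one_mem D)
    (derivative_expMul hF c)
  rwa [scaleSeries_one] at sheffer_tp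

end Homogenization

/-! ### Logarithmic, fractional and signed triangles -/

section Triangles

variable {f g : ℝ⟦X⟧}

theorem constantCoeff_qMul (hf : constantCoeff f = 0) : constantCoeff (qMul f) = 0 :=
  constantCoeff_C_mul (constantCoeff_map_eq_zero _ hf) _

theorem coeff_qMul_pow (f : ℝ⟦X⟧) (n k : ℕ) :
    coeff n (qMul f ^ k) = Polynomial.C (coeff n (f ^ k)) * Polynomial.X ^ k := by
  rw [qMul, mul_pow, ← map_pow, ← map_pow, coeff_C_mul, coeff_map, mul_comm]

theorem coeff_coeff_map_subst_qMul (hf : constantCoeff f = 0) (h : ℝ⟦X⟧) (n k : ℕ) :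
    (coeff n ((PowerSeries.map Polynomial.C h).subst (qMul f))).coeff k =
      coeff k h * coeff n (f ^ k) := by
  rw [coeff_subst_eq_sum (constantCoeff_qMul hf) _ (show n < n + k + 1 by omega),
    Polynomial.finsetSum_coeff]
  simp_rw [coeff_map, coeff_qMul_pow, Polynomial.coeff_C_mul, Polynomial.coeff_X_pow,
    mul_ite, mul_one, mul_zero]
  rw [sum_ite_eq, if_pos (mem_range.2 (by omega))]

theorem invOfUnit_one_sub_qMul (hf : constantCoeff f = 0) :
    invOfUnit (1 - qMul f) 1 =
      (PowerSeries.map Polynomial.C (PowerSeries.mk (1 : ℕ → ℝ))).subst (qMul f) := by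
  have hq := constantCoeff_qMul hf
  have hs : HasSubst (qMul f) := .of_constantCoeff_zero' hq
  have map_mk_one :
      PowerSeries.map Polynomial.C (PowerSeries.mk (1 : ℕ → ℝ)) = PowerSeries.mk 1 := by
    ext n
    simp
  have geometric : (PowerSeries.mk (1 : ℕ → Polynomial ℝ)).subst (qMul f) * (1 - qMul f) = 1 := by
    have h := congrArg (subst (qMul f)) (mk_one_mul_one_sub_eq_one (Polynomial ℝ))
    simpa only [← coe_substAlgHom hs, map_mul, map_sub, map_one, substAlgHom_X hs] using h
  rw [map_mk_one]
  exact (left_inv_eq_right_inv geometric (mul_invOfUnit _ 1 (by simp [hq]))).symm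

theorem fracTriangle_eq (hf : constantCoeff f = 0) :
    fracTriangle f = fun n k => (k.factorial : ℝ) * sheffer f 1 n k := by
  funext n k
  rw [fracTriangle, fracPoly, invOfUnit_one_sub_qMul hf, Polynomial.coeff_smul,
    coeff_coeff_map_subst_qMul hf, coeff_mk, sheffer_one_eq hf, nsmul_eq_mul, Pi.one_apply]
  linear_combination (-(n.factorial * coeff n (f ^ k))) * factorial_mul_invFact (A := ℝ) k

theorem coeff_coeff_log_subst_neg_qMul (hf : constantCoeff f = 0) (n k : ℕ) :
    (coeff n ((PowerSeries.log (Polynomial ℝ)).subst (-qMul f))).coeff k =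
      coeff k (PowerSeries.log ℝ) * ((-1) ^ k * coeff n (f ^ k)) := by
  have neg_qMul : -qMul f = qMul (-f) := by rw [qMul, qMul, map_neg, mul_neg]
  rw [neg_qMul, ← map_log Polynomial.C, coeff_coeff_map_subst_qMul (by rw [map_neg, hf, neg_zero]),
    neg_pow, ← map_one (C (R := ℝ)), ← map_neg, ← map_pow, coeff_C_mul]

theorem logTriangle_eq (hf : constantCoeff f = 0) :
    logTriangle f = fun n k => ((k - 1).factorial : ℝ) * sheffer f 1 n k := by
  funext n k
  rw [logTriangle, logPoly, sheffer_one_eq hf]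
  rcases n with _ | n
  · rcases k with _ | k
    · simp [invFact_zero]
    · simp [coeff_pow_eq_zero hf k.succ_pos, Polynomial.coeff_one]
  rw [if_neg n.succ_ne_zero, Polynomial.coeff_neg, Polynomial.coeff_smul,
    coeff_coeff_log_subst_neg_qMul hf, nsmul_eq_mul, coeff_log]
  rcases k with _ | k
  · simp [coeff_one]
  have coeff_log_mul : algebraMap ℚ ℝ ((-1) ^ (k + 1 + 1) / (k + 1 : ℕ)) * (-1) ^ (k + 1) =
      -(k.factorial * invFact ℝ (k + 1)) := by
    have succ_ne : ((k + 1 : ℕ) : ℝ) ≠ 0 := Nat.cast_ne_zero.2 k.succ_ne_zero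
    rw [map_div₀, map_pow, map_neg, map_one, map_natCast, div_mul_eq_mul_div, ← pow_add,
      Odd.neg_one_pow ⟨k + 1, by ring⟩, div_eq_iff succ_ne]
    linear_combination factorial_mul_invFact (A := ℝ) k +
      (k.factorial : ℝ) * succ_mul_invFact (A := ℝ) k
  rw [if_neg k.succ_ne_zero, Nat.add_sub_cancel]
  linear_combination (-((n + 1).factorial * coeff (n + 1) (f ^ (k + 1)))) * coeff_log_mul

theorem signed_scale_col (v : ℕ → ℝ) (M : ℕ → ℕ → ℝ) :
    signed (fun n k => v k * M n k) = fun n k => v k * signed M n k := by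
  funext n k
  exact mul_left_comm _ _ _

theorem TP.scale_col {M : ℕ → ℕ → ℝ} (hM : TP (Subsemiring.nonneg ℝ) M) {v : ℕ → ℝ}
    (hv : ∀ k, 0 ≤ v k) : TP (Subsemiring.nonneg ℝ) fun n k => v k * M n k := by
  have hscale := hM.scale (u := fun _ => 1) (fun _ => one_mem _) hv
  simpa only [one_mul, mul_comm (v _)] using hscale

theorem subst_derivative_mul_derivative (hf : constantCoeff f = 0) (hgf : g.subst f = X) :
    (derivative ℝ g).subst f * derivative ℝ f = 1 := by
  rw [← derivative_subst (.of_constantCoeff_zero' hf), hgf, derivative_X]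

theorem derivative_eq_subst_of_inverse (hf : constantCoeff f = 0) (hgf : g.subst f = X) :
    derivative ℝ f = ((derivative ℝ g)⁻¹).subst f := by
  have hs : HasSubst f := .of_constantCoeff_zero' hf
  have chain := subst_derivative_mul_derivative hf hgf
  have hg : constantCoeff (derivative ℝ g) ≠ 0 := by
    intro h
    have hsubst : constantCoeff ((derivative ℝ g).subst f) = 0 :=
      constantCoeff_subst_eq_zero hf _ h
    simpa [hsubst] using congrArg constantCoeff chain
  refine (left_inv_eq_right_inv ?_ chain).symm
  rw [← subst_mul hs, PowerSeries.inv_mul_cancel _ hg, ← coe_substAlgHom hs, map_one]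

theorem TP.signed_sheffer_of_inverse (hT : TP (Subsemiring.nonneg ℝ) (sheffer f 1))
    (hf : constantCoeff f = 0) (hg : constantCoeff g = 0) (hgf : g.subst f = X) :
    TP (Subsemiring.nonneg ℝ) (signed (sheffer g 1)) := by
  have coeff_one_ne : coeff 1 f ≠ 0 := by
    intro h
    have coeff_chain := congrArg constantCoeff (subst_derivative_mul_derivative hf hgf)
    rw [map_mul, ← coeff_zero_eq_constantCoeff_apply (derivative ℝ f), coeff_derivative, zero_add,
      h, zero_mul, mul_zero, map_one] at coeff_chain
    exact zero_ne_one coeff_chain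
  refine hT.signed_of_isProd_one (fun _ _ => sheffer_of_lt hf 1)
    (fun n => by rw [sheffer_self hf, map_one, one_mul]; exact pow_ne_zero n coeff_one_ne) ?_
  have group_law := isProd_sheffer_sheffer hf hg 1 1
  rwa [hgf, one_mul, ← coe_substAlgHom (.of_constantCoeff_zero' hf), map_one,
    funext₂ sheffer_X_one] at group_law

theorem TP.logTriangle_of_sheffer (hT : TP (Subsemiring.nonneg ℝ) (sheffer f 1))
    (hf : constantCoeff f = 0) : TP (Subsemiring.nonneg ℝ) (logTriangle f) := by
  rw [logTriangle_eq hf]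
  exact hT.scale_col fun _ => Nat.cast_nonneg _

theorem TP.fracTriangle_of_sheffer (hT : TP (Subsemiring.nonneg ℝ) (sheffer f 1))
    (hf : constantCoeff f = 0) : TP (Subsemiring.nonneg ℝ) (fracTriangle f) := by
  rw [fracTriangle_eq hf]
  exact hT.scale_col fun _ => Nat.cast_nonneg _

theorem TP.signed_logTriangle_of_sheffer (hT : TP (Subsemiring.nonneg ℝ) (signed (sheffer f 1)))
    (hf : constantCoeff f = 0) :
    TP (Subsemiring.nonneg ℝ) (signed (logTriangle f)) := by
  rw [logTriangle_eq hf, signed_scale_col]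
  exact hT.scale_col fun _ => Nat.cast_nonneg _

theorem TP.signed_fracTriangle_of_sheffer (hT : TP (Subsemiring.nonneg ℝ) (signed (sheffer f 1)))
    (hf : constantCoeff f = 0) :
    TP (Subsemiring.nonneg ℝ) (signed (fracTriangle f)) := by
  rw [fracTriangle_eq hf, signed_scale_col]
  exact hT.scale_col fun _ => Nat.cast_nonneg _

end Triangles

/-! ### Branched continued fractions -/

section Branched

variable {R : Type*} [CommRing R]

theorem hasBranchedFraction_of_mul_eq_one {m : ℕ} {a : ℕ → R} {F : ℕ → R⟦X⟧}
    (hF : ∀ k, F k * (1 - C (a k) * X * ∏ i : Fin m, F (k + (i + 1))) = 1) :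
    HasBranchedFraction m a (F 0) := by
  have hF0 : ∀ k, constantCoeff (F k) = 1 := fun k => by
    simpa using congrArg constantCoeff (hF k)
  have convergent_eq : ∀ N k, branchedConvergent m a (N + 1) k *
      (1 - C (a k) * X * ∏ i : Fin m, branchedConvergent m a N (k + (i + 1))) = 1 := fun N k =>
    invOfUnit_mul _ _ (by simp)
  have convergent_sub : ∀ N k, X ^ (N + 1) ∣ branchedConvergent m a N k - F k := by
    intro N
    induction N with
    | zero =>
      intro k
      rw [zero_add, pow_one, X_dvd_iff]
      simp [branchedConvergent, hF0]
    | succ N ih =>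
      intro k
      have prod_congr : ∏ i : Fin m, branchedConvergent m a N (k + (i + 1)) ≡
          ∏ i : Fin m, F (k + (i + 1)) [SMOD Ideal.span {(X : R⟦X⟧) ^ (N + 1)}] :=
        .prod fun i _ => SModEq.sub_mem.2 (Ideal.mem_span_singleton.2 (ih _))
      obtain ⟨e, he⟩ := Ideal.mem_span_singleton.1 (SModEq.sub_mem.1 prod_congr)
      refine ⟨branchedConvergent m a (N + 1) k * F k * C (a k) * e, ?_⟩
      linear_combination (branchedConvergent m a (N + 1) k * F k * C (a k) * X) * he +
        F k * convergent_eq N k - branchedConvergent m a (N + 1) k * hF k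
  intro n
  filter_upwards [eventually_ge_atTop n] with N hN
  rw [← sub_eq_zero, ← map_sub]
  exact X_pow_dvd_iff.1 (convergent_sub N 0) n (by omega)

/-- The **Euler–Gauss recurrence method** for branched continued fractions. -/
theorem hasBranchedFraction_of_recurrence {m : ℕ} {a : ℕ → R} {g : ℕ → R⟦X⟧} (h0 : g 0 = 1)
    (hc : ∀ k, constantCoeff (g k) = 1)
    (hg : ∀ k, g (k + 1) - g k = C (a k) * X * g (k + m + 1)) :
    HasBranchedFraction m a (g 1) := by
  let u : ℕ → R⟦X⟧ := fun k => invOfUnit (g k) 1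
  have hgu : ∀ k, g k * u k = 1 := fun k => mul_invOfUnit _ _ (by simpa using hc k)
  have telescope : ∀ k n, ∏ i ∈ range n, g (k + (i + 1) + 1) * u (k + (i + 1)) =
      g (k + n + 1) * u (k + 1) := by
    intro k n
    induction n with
    | zero => simp [hgu]
    | succ n ih =>
      rw [prod_range_succ, ih, ← add_assoc]
      linear_combination (g (k + n + 1 + 1) * u (k + 1)) * hgu (k + n + 1)
  have ratio_zero : g 1 = g (0 + 1) * u 0 := by
    have h := hgu 0
    rw [h0, one_mul] at h
    rw [h, mul_one]
  rw [ratio_zero]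
  refine hasBranchedFraction_of_mul_eq_one (F := fun k => g (k + 1) * u k) fun k => ?_
  have htel := telescope k m
  rw [prod_range] at htel
  rw [htel]
  linear_combination (u k) * hg k + hgu k - (C (a k) * X * g (k + m + 1) * u k) * hgu (k + 1)

variable {m : ℕ}

/-- The sequence `1, G 0 0, …, G 0 m, G 1 0, …, G 1 m, …`: the double sequence `G`, whose rows are
cut to length `m + 1`, listed by heights and preceded by `1`. -/
noncomputable def blockHeights (m : ℕ) (G : ℕ → ℕ → R⟦X⟧) : ℕ → R⟦X⟧
  | 0 => 1
  | k + 1 => G (k / (m + 1)) (k % (m + 1))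

theorem blockHeights_succ (G : ℕ → ℕ → R⟦X⟧) (r : ℕ) {i : ℕ} (hi : i ≤ m) :
    blockHeights m G ((m + 1) * r + i + 1) = G r i := by
  have hi' : i < m + 1 := by omega
  rw [blockHeights, Nat.mul_add_div m.succ_pos, Nat.mul_add_mod, Nat.div_eq_of_lt hi',
    Nat.mod_eq_of_lt hi', add_zero]

theorem blockSeq_mul (c : R) (y : Fin m → R) (r : ℕ) : blockSeq c y ((m + 1) * r) = c :=
  dif_pos (Nat.mul_mod_right _ _)

theorem blockSeq_mul_add_succ (c : R) (y : Fin m → R) (r : ℕ) (i : Fin m) :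
    blockSeq c y ((m + 1) * r + (i + 1)) = (r + 1 : ℕ) * y i := by
  have hi : (i : ℕ) + 1 < m + 1 := by omega
  have hmod : ((m + 1) * r + (i + 1)) % (m + 1) = i + 1 := by
    rw [Nat.mul_add_mod, Nat.mod_eq_of_lt hi]
  have hdiv : ((m + 1) * r + (i + 1)) / (m + 1) = r := by
    rw [Nat.mul_add_div m.succ_pos, Nat.div_eq_of_lt hi, add_zero]
  rw [blockSeq, dif_neg (by omega)]
  simp only [hdiv, hmod, Nat.add_sub_cancel]

theorem hasBranchedFraction_blockSeq {c : R} {y : Fin m → R} {G : ℕ → ℕ → R⟦X⟧}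
    (hconst : ∀ r i, constantCoeff (G r i) = 1)
    (h_zero_zero : G 0 0 = 1 + C c * X * G 0 m)
    (h_succ_zero : ∀ r, G (r + 1) 0 = G r m + C c * X * G (r + 1) m)
    (h_succ : ∀ r (i : Fin m), G r (i + 1) = G r i + C ((r + 1 : ℕ) * y i) * X * G (r + 1) i) :
    HasBranchedFraction m (blockSeq c y) (G 0 0) := by
  have first_height : G 0 0 = blockHeights m G 1 := (blockHeights_succ G 0 m.zero_le).symm
  rw [first_height]
  refine hasBranchedFraction_of_recurrence rfl (fun k => ?_) fun k => ?_
  · rcases k with _ | k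
    exacts [map_one _, hconst _ _]
  obtain ⟨r, i, hi, rfl⟩ : ∃ r i, i ≤ m ∧ k = (m + 1) * r + i :=
    ⟨k / (m + 1), k % (m + 1), Nat.lt_succ_iff.1 (Nat.mod_lt _ m.succ_pos),
      (Nat.div_add_mod _ _).symm⟩
  rw [blockHeights_succ G r hi, sub_eq_iff_eq_add']
  rcases i with _ | i
  · rw [add_zero, blockSeq_mul, blockHeights_succ G r le_rfl]
    rcases r with _ | r
    · exact h_zero_zero
    · have previous : (m + 1) * (r + 1) = (m + 1) * r + m + 1 := by ring
      rw [previous, blockHeights_succ G r le_rfl, h_succ_zero]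
  · have next : (m + 1) * r + (i + 1) + m + 1 = (m + 1) * (r + 1) + i + 1 := by ring
    rw [blockSeq_mul_add_succ c y r ⟨i, hi⟩, next, blockHeights_succ G (r + 1) (by omega),
      ← add_assoc, blockHeights_succ G r (by omega)]
    exact h_succ r ⟨i, hi⟩

variable [Algebra ℚ R]

/-- The partial products `exp (c F) ∏_{l < i} (1 + y_l F)`, which lead from `exp (c F)` to its
derivative up to the factor `c`. -/
noncomputable def partialProd (c : R) (y : Fin m → R) (F : R⟦X⟧) (i : ℕ) : R⟦X⟧ :=
  expMul c F * ∏ l ∈ range i, (1 + C (if h : l < m then y ⟨l, h⟩ else 0) * F)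

/-- The generating function of the `r`-th column of the Sheffer triangle of the `i`-th partial
product. In the recurrence it stands at height `(m + 1) r + i`. -/
noncomputable def heightSeries (c : R) (y : Fin m → R) (F : R⟦X⟧) (r i : ℕ) : R⟦X⟧ :=
  PowerSeries.mk fun n => sheffer F (partialProd c y F i) (n + r) r

variable {c : R} {y : Fin m → R} {F : R⟦X⟧}

theorem partialProd_zero (c : R) (y : Fin m → R) (F : R⟦X⟧) :
    partialProd c y F 0 = expMul c F := by
  rw [partialProd, prod_range_zero, mul_one]

theorem partialProd_succ (c : R) (y : Fin m → R) (F : R⟦X⟧) (i : Fin m) :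
    partialProd c y F (i + 1) = partialProd c y F i * (1 + C (y i) * F) := by
  rw [partialProd, prod_range_succ, dif_pos i.2, ← mul_assoc, ← partialProd]

theorem partialProd_last (hF' : derivative R F = ∏ i, (1 + C (y i) * F)) :
    partialProd c y F m = expMul c F * derivative R F := by
  rw [partialProd, hF', prod_range]
  simp

theorem constantCoeff_partialProd (hF : constantCoeff F = 0) (i : ℕ) :
    constantCoeff (partialProd c y F i) = 1 := by
  simp [partialProd, constantCoeff_expMul hF, map_prod, hF]

theorem constantCoeff_heightSeries (hF : constantCoeff F = 0)
    (hF' : derivative R F = ∏ i, (1 + C (y i) * F)) (r i : ℕ) :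
    constantCoeff (heightSeries c y F r i) = 1 := by
  have coeff_one_F : coeff 1 F = 1 := by
    simpa [coeff_derivative, map_prod, hF] using congrArg (coeff 0) hF'
  rw [← coeff_zero_eq_constantCoeff_apply, heightSeries, coeff_mk, zero_add, sheffer_self hF,
    constantCoeff_partialProd hF, coeff_one_F, one_pow, mul_one]

theorem sheffer_mul_one_add_C_mul (hF : constantCoeff F = 0) (G : R⟦X⟧) (a : R) (n k : ℕ) :
    sheffer F (G * (1 + C a * F)) n k =
      sheffer F G n k + (k + 1 : ℕ) * a * sheffer F G n (k + 1) := by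
  have expand : G * (1 + C a * F) * F ^ k = G * F ^ k + C a * (G * F ^ (k + 1)) := by ring
  simp only [sheffer_eq hF, expand, map_add, coeff_C_mul, ← succ_mul_invFact k]
  ring

theorem coeff_X_mul_heightSeries_succ (hF : constantCoeff F = 0) (n r i : ℕ) :
    coeff n (X * heightSeries c y F (r + 1) i) =
      sheffer F (partialProd c y F i) (n + r) (r + 1) := by
  rcases n with _ | n
  · rw [coeff_zero_X_mul, sheffer_of_lt hF _ (by omega)]
  · rw [coeff_succ_X_mul, heightSeries, coeff_mk, add_right_comm, add_assoc]

theorem heightSeries_succ (hF : constantCoeff F = 0) (r : ℕ) (i : Fin m) :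
    heightSeries c y F r (i + 1) = heightSeries c y F r i +
      C ((r + 1 : ℕ) * y i) * X * heightSeries c y F (r + 1) i := by
  ext n
  rw [map_add, mul_assoc, coeff_C_mul, coeff_X_mul_heightSeries_succ hF, heightSeries,
    heightSeries, coeff_mk, coeff_mk, partialProd_succ, sheffer_mul_one_add_C_mul hF]

theorem sheffer_expMul_succ (hF : constantCoeff F = 0)
    (hF' : derivative R F = ∏ i, (1 + C (y i) * F)) (n k : ℕ) :
    sheffer F (expMul c F) (n + 1) k = c * sheffer F (partialProd c y F m) n k +
      if k = 0 then 0 else sheffer F (partialProd c y F m) n (k - 1) := by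
  rw [partialProd_last hF', sheffer_succ hF (derivative_expMul hF c)]

theorem heightSeries_succ_zero (hF : constantCoeff F = 0)
    (hF' : derivative R F = ∏ i, (1 + C (y i) * F)) (r : ℕ) :
    heightSeries c y F (r + 1) 0 = heightSeries c y F r m +
      C c * X * heightSeries c y F (r + 1) m := by
  ext n
  rw [map_add, mul_assoc, coeff_C_mul, coeff_X_mul_heightSeries_succ hF, heightSeries,
    heightSeries, coeff_mk, coeff_mk, partialProd_zero, ← add_assoc, sheffer_expMul_succ hF hF',
    if_neg r.succ_ne_zero, Nat.add_sub_cancel, add_comm]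

theorem heightSeries_zero_zero (hF : constantCoeff F = 0)
    (hF' : derivative R F = ∏ i, (1 + C (y i) * F)) :
    heightSeries c y F 0 0 = 1 + C c * X * heightSeries c y F 0 m := by
  ext n
  rw [map_add, mul_assoc, coeff_C_mul, heightSeries, coeff_mk, partialProd_zero, add_zero]
  rcases n with _ | n
  · rw [sheffer_zero_zero hF, constantCoeff_expMul hF, coeff_zero_X_mul, coeff_zero_one, mul_zero,
      add_zero]
  · rw [coeff_succ_X_mul, heightSeries, coeff_mk, sheffer_expMul_succ hF hF', if_pos rfl,
      coeff_one, if_neg n.succ_ne_zero, add_zero, zero_add, add_zero]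

theorem hasBranchedFraction_expMul (hF : constantCoeff F = 0)
    (hF' : derivative R F = ∏ i, (1 + C (y i) * F)) (c : R) :
    HasBranchedFraction m (blockSeq c y)
      (PowerSeries.mk fun n => sheffer F (expMul c F) n 0) := by
  have first_height :
      (PowerSeries.mk fun n => sheffer F (expMul c F) n 0) = heightSeries c y F 0 0 := by
    rw [heightSeries, partialProd_zero]
    rfl
  rw [first_height]
  exact hasBranchedFraction_blockSeq (constantCoeff_heightSeries hF hF')
    (heightSeries_zero_zero hF hF') (heightSeries_succ_zero hF hF') (heightSeries_succ hF)

end Branched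

/-! ### Polynomials with nonnegative coefficients -/

section NonnegativeCoefficients

variable {A : Type*} [CommRing A]

/-- The polynomials whose coefficients belong to the subsemiring `D`. For the nonnegative elements
`D` of `ℝ` this is the positivity notion `NonnegCoeff`, and iterating it gives `NonnegCoeff₂`. -/
def coeffSubsemiring (D : Subsemiring A) : Subsemiring (Polynomial A) where
  carrier := {p | ∀ i, p.coeff i ∈ D}
  mul_mem' hp hq i := by
    rw [Polynomial.coeff_mul]
    exact sum_mem fun x _ => mul_mem (hp _) (hq _)
  one_mem' i := by
    rw [Polynomial.coeff_one]
    split_ifs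
    exacts [one_mem D, zero_mem D]
  add_mem' hp hq i := by
    rw [Polynomial.coeff_add]
    exact add_mem (hp i) (hq i)
  zero_mem' _ := zero_mem D

variable {D : Subsemiring A}

theorem C_mem_coeffSubsemiring {a : A} (ha : a ∈ D) : Polynomial.C a ∈ coeffSubsemiring D := by
  intro i
  rw [Polynomial.coeff_C]
  split_ifs
  exacts [ha, zero_mem D]

theorem X_mem_coeffSubsemiring : Polynomial.X ∈ coeffSubsemiring D := by
  intro i
  rw [Polynomial.coeff_X]
  split_ifs
  exacts [one_mem D, zero_mem D]

theorem reflect_eq_sum {p : Polynomial A} {n : ℕ} (h : ∀ k, n < k → p.coeff k = 0) :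
    Polynomial.reflect n p =
      ∑ k ∈ range (n + 1), Polynomial.C (p.coeff k) * Polynomial.X ^ (n - k) := by
  have hp : p.natDegree < n + 1 :=
    Nat.lt_succ_of_le (Polynomial.natDegree_le_iff_coeff_eq_zero.2 fun k hk => h k hk)
  let reflectHom := AddMonoidHom.mk' (Polynomial.reflect (R := A) n) fun p q =>
    Polynomial.reflect_add p q n
  refine (congrArg reflectHom (p.as_sum_range_C_mul_X_pow' hp)).trans ?_
  rw [map_sum]
  refine sum_congr rfl fun k hk => ?_
  have hkn : k ≤ n := Nat.lt_succ_iff.1 (mem_range.1 hk)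
  exact (Polynomial.reflect_C_mul_X_pow n k).trans (by rw [Polynomial.revAt_le hkn])

theorem algebraMap_mem_coeffSubsemiring [Algebra ℝ A]
    (hD : ∀ x : ℝ, 0 ≤ x → algebraMap ℝ A x ∈ D) (x : ℝ) (hx : 0 ≤ x) :
    algebraMap ℝ (Polynomial A) x ∈ coeffSubsemiring D :=
  C_mem_coeffSubsemiring (hD x hx)

end NonnegativeCoefficients

section ShefferExp

variable {f φ : ℝ⟦X⟧}

theorem shefferExp_eq_sum (hf : constantCoeff f = 0) (n : ℕ) :
    shefferExp f n = ∑ k ∈ range (n + 1),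
      algebraMap ℝ (Polynomial (Polynomial ℝ)) (sheffer f 1 n k) *
        (Polynomial.C Polynomial.X + Polynomial.X) ^ k * 1 ^ (n - k) := by
  have hF : constantCoeff (liftSeries f) = 0 := constantCoeff_map_eq_zero _ hf
  rw [shefferExp, expLam, shefferPoly_expMul_eq_sum hF]
  refine sum_congr rfl fun k _ => ?_
  rw [liftSeries, map_sheffer_one Polynomial.C hf, one_pow, mul_one, add_comm Polynomial.X]
  rfl

theorem shefferExpStar_eq_sum (hf : constantCoeff f = 0) (n : ℕ) :
    shefferExpStar f n = ∑ k ∈ range (n + 1),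
      algebraMap ℝ (Polynomial (Polynomial ℝ)) (sheffer f 1 n k) *
        (Polynomial.X * Polynomial.C Polynomial.X + 1) ^ k * Polynomial.X ^ (n - k) := by
  have hF : constantCoeff (liftSeries f) = 0 := constantCoeff_map_eq_zero _ hf
  have homogenized :=
    sum_sheffer_expMul (Polynomial.C (R := Polynomial ℝ)) hF Polynomial.X 1 Polynomial.X n
  simp only [one_pow, mul_one] at homogenized
  rw [shefferExpStar, shefferExp, expLam, reflect_eq_sum fun k hk => sheffer_of_lt hF _ hk]
  refine homogenized.trans (sum_congr rfl fun k _ => ?_)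
  rw [liftSeries, map_sheffer_one Polynomial.C hf, add_comm 1, mul_comm Polynomial.X]
  rfl

theorem algebraMap_mem_nonneg (x : ℝ) (hx : 0 ≤ x) : algebraMap ℝ ℝ x ∈ Subsemiring.nonneg ℝ := hx

theorem tp_hankel_shefferExp (hf : constantCoeff f = 0) (hfφ : derivative ℝ f = φ.subst f)
    (hφ : IsPF φ) : TP (coeffSubsemiring (coeffSubsemiring (Subsemiring.nonneg ℝ)))
      fun i j => shefferExp f (i + j) := by
  simp_rw [shefferExp_eq_sum hf]
  exact tp_hankel_sum_sheffer
    (algebraMap_mem_coeffSubsemiring (algebraMap_mem_coeffSubsemiring algebraMap_mem_nonneg))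
    hf hfφ hφ (add_mem (C_mem_coeffSubsemiring X_mem_coeffSubsemiring) X_mem_coeffSubsemiring)
    (one_mem _)

theorem tp_hankel_shefferExpStar (hf : constantCoeff f = 0) (hfφ : derivative ℝ f = φ.subst f)
    (hφ : IsPF φ) : TP (coeffSubsemiring (coeffSubsemiring (Subsemiring.nonneg ℝ)))
      fun i j => shefferExpStar f (i + j) := by
  simp_rw [shefferExpStar_eq_sum hf]
  exact tp_hankel_sum_sheffer
    (algebraMap_mem_coeffSubsemiring (algebraMap_mem_coeffSubsemiring algebraMap_mem_nonneg))
    hf hfφ hφ (add_mem (mul_mem X_mem_coeffSubsemiring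
      (C_mem_coeffSubsemiring X_mem_coeffSubsemiring)) (one_mem _)) X_mem_coeffSubsemiring

theorem tp_hankel_egfCoeff_succ (hf : constantCoeff f = 0) (hfφ : derivative ℝ f = φ.subst f)
    (hφ : IsPF φ) : TP (Subsemiring.nonneg ℝ) fun i j => egfCoeff f (i + j + 1) := by
  have hankel_tp := tp_hankel_sum_sheffer_succ algebraMap_mem_nonneg hf hfφ hφ
    (zero_mem _) (one_mem _)
  have egfCoeff_eq (n : ℕ) : egfCoeff f n = sheffer f 1 n 1 := by
    rw [sheffer_one_eq hf, egfCoeff, pow_one, show invFact ℝ 1 = 1 by simp [invFact], mul_one]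
  simpa [egfCoeff_eq, sum_range_succ'] using hankel_tp

theorem tp_sheffer_one (hf : constantCoeff f = 0) (hfφ : derivative ℝ f = φ.subst f)
    (hφ : IsPF φ) : TP (Subsemiring.nonneg ℝ) (sheffer f 1) := by
  have sheffer_tp := tp_sheffer_expMul algebraMap_mem_nonneg hf hfφ hφ (zero_mem _)
  have map_id : PowerSeries.map (algebraMap ℝ ℝ) f = f := by
    ext
    simp
  rwa [map_id, expMul_zero hf] at sheffer_tp

theorem convolutionPreservesSM_sheffer_expMul (hf : constantCoeff f = 0)
    (hfφ : derivative ℝ f = φ.subst f) (hφ : IsPF φ) {c : ℝ} (hc : 0 ≤ c) :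
    ConvolutionPreservesSM (sheffer f (expMul c f)) := by
  refine convolutionPreservesSM_of_isSM fun s t hs ht => ?_
  have hankel_tp := tp_hankel_sum_sheffer algebraMap_mem_nonneg hf hfφ hφ
    (c := s + c * t) (w := t) (add_nonneg hs (mul_nonneg hc ht)) ht
  exact (funext (sum_sheffer_expMul (RingHom.id ℝ) hf c s t)).symm ▸ hankel_tp.isSM

theorem convolutionPreservesSM_sheffer_succ_succ (hf : constantCoeff f = 0)
    (hfφ : derivative ℝ f = φ.subst f) (hφ : IsPF φ) :
    ConvolutionPreservesSM fun n k => sheffer f 1 (n + 1) (k + 1) :=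
  convolutionPreservesSM_of_isSM fun _ _ hs ht =>
    (tp_hankel_sum_sheffer_succ algebraMap_mem_nonneg hf hfφ hφ hs ht).isSM

theorem convolutionPreservesSM_fracTriangle (hf : constantCoeff f = 0)
    (hfφ : derivative ℝ f = φ.subst f) (hφ : IsPF φ) :
    ConvolutionPreservesSM (fracTriangle f) := by
  intro x y hx hy
  have sheffer_conv := convolutionPreservesSM_sheffer_expMul hf hfφ hφ le_rfl
    _ y (isSM_factorial.mul hx) hy
  rw [fracTriangle_eq hf]
  simpa only [expMul_zero hf, mul_left_comm, mul_assoc] using sheffer_conv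

theorem hasBranchedFraction_shefferExp {m : ℕ} {x : Fin m → ℝ} (hf : constantCoeff f = 0)
    (hfx : derivative ℝ f = (∏ i, (1 + C (x i) * X)).subst f) :
    HasBranchedFraction m
      (blockSeq (Polynomial.C Polynomial.X + Polynomial.X)
        fun i => Polynomial.C (Polynomial.C (x i)))
      (PowerSeries.mk (shefferExp f)) := by
  have fraction := hasBranchedFraction_expMul (constantCoeff_scaleSeries hf 1)
    (derivative_scaleSeries_eq_prod hf hfx 1)
    (Polynomial.C Polynomial.X + Polynomial.X : Polynomial (Polynomial ℝ))
  simp_rw [sheffer_scaleSeries_expMul_zero hf, ← shefferExp_eq_sum hf, one_mul] at fraction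
  exact fraction

theorem hasBranchedFraction_shefferExpStar {m : ℕ} {x : Fin m → ℝ} (hf : constantCoeff f = 0)
    (hfx : derivative ℝ f = (∏ i, (1 + C (x i) * X)).subst f) :
    HasBranchedFraction m
      (blockSeq (Polynomial.X * Polynomial.C Polynomial.X + 1)
        fun i => Polynomial.X * Polynomial.C (Polynomial.C (x i)))
      (PowerSeries.mk (shefferExpStar f)) := by
  have fraction := hasBranchedFraction_expMul (constantCoeff_scaleSeries hf Polynomial.X)
    (derivative_scaleSeries_eq_prod hf hfx Polynomial.X)
    (Polynomial.X * Polynomial.C Polynomial.X + 1 : Polynomial (Polynomial ℝ))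
  simp_rw [sheffer_scaleSeries_expMul_zero hf, ← shefferExpStar_eq_sum hf] at fraction
  exact fraction

end ShefferExp

end ShefferTP

open ShefferTP

theorem mainTheorem6 (f : PowerSeries ℝ)
    (hf0 : PowerSeries.constantCoeff f = 0)
    (hf1 : PowerSeries.coeff 1 f ≠ 0)
    -- `1 / f̄'(t)` is a PF function, `f̄` being the compositional inverse of `f`
    (hPF : ShefferTP.IsPF
      (PowerSeries.derivative ℝ (f.substInvOfIsUnit hf1.isUnit))⁻¹) :
    -- (i)
    (ShefferTP.IsPolySM₂ (ShefferTP.shefferExp f) ∧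
      ShefferTP.IsLogConvexOfOrder ShefferTP.NonnegCoeff₂ 3 (ShefferTP.shefferExp f) ∧
      ShefferTP.IsPolySM₂ (ShefferTP.shefferExpStar f) ∧
      ShefferTP.IsLogConvexOfOrder ShefferTP.NonnegCoeff₂ 3 (ShefferTP.shefferExpStar f)) ∧
    -- (ii)
    (ShefferTP.IsSM (fun n => ShefferTP.egfCoeff f (n + 1)) ∧
      ShefferTP.IsLogConvexOfOrder (fun x : ℝ => 0 ≤ x) 3
        (fun n => ShefferTP.egfCoeff f (n + 1))) ∧
    -- (iii)
    ShefferTP.IsPolyTP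
      (ShefferTP.sheffer (ShefferTP.liftSeries f) (ShefferTP.expLam f)) ∧
    -- (iv)
    (ShefferTP.IsTP (ShefferTP.logTriangle f) ∧
      ShefferTP.IsTP (ShefferTP.fracTriangle f) ∧
      ShefferTP.IsTP
        (ShefferTP.signed (ShefferTP.sheffer (f.substInvOfIsUnit hf1.isUnit) 1)) ∧
      ShefferTP.IsTP
        (ShefferTP.signed (ShefferTP.logTriangle (f.substInvOfIsUnit hf1.isUnit))) ∧
      ShefferTP.IsTP
        (ShefferTP.signed (ShefferTP.fracTriangle (f.substInvOfIsUnit hf1.isUnit)))) ∧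
    -- (v)
    ((∀ lam : ℝ, 0 ≤ lam → ShefferTP.ConvolutionPreservesSM
        (ShefferTP.sheffer f (ShefferTP.expMul lam f))) ∧
      ShefferTP.ConvolutionPreservesSM (fun n k => ShefferTP.sheffer f 1 (n + 1) (k + 1)) ∧
      ShefferTP.ConvolutionPreservesSM (ShefferTP.fracTriangle f)) ∧
    -- (vi), where `Polynomial.C Polynomial.X` is `λ` and `Polynomial.X` is `q`
    (∀ (m : ℕ) (x : Fin m → ℝ),
      (PowerSeries.derivative ℝ (f.substInvOfIsUnit hf1.isUnit))⁻¹
          = ∏ i, (1 + PowerSeries.C (x i) * PowerSeries.X) →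
      ShefferTP.HasBranchedFraction m
          (ShefferTP.blockSeq
            (Polynomial.C Polynomial.X + Polynomial.X)
            (fun i => Polynomial.C (Polynomial.C (x i))))
          (PowerSeries.mk (ShefferTP.shefferExp f)) ∧
      ShefferTP.HasBranchedFraction m
          (ShefferTP.blockSeq
            (Polynomial.X * Polynomial.C Polynomial.X + 1)
            (fun i => Polynomial.X * Polynomial.C (Polynomial.C (x i))))
          (PowerSeries.mk (ShefferTP.shefferExpStar f))) := by
  set g := f.substInvOfIsUnit hf1.isUnit
  have hg0 : constantCoeff g = 0 := constantCoeff_substInvOfIsUnit f hf1.isUnit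
  have hgf : g.subst f = X := subst_substInvOfIsUnit_left f hf0 hf1.isUnit
  have hfφ := derivative_eq_subst_of_inverse hf0 hgf
  have exp_tp := tp_hankel_shefferExp hf0 hfφ hPF
  have expStar_tp := tp_hankel_shefferExpStar hf0 hfφ hPF
  have egf_tp := tp_hankel_egfCoeff_succ hf0 hfφ hPF
  have egf_logConvex :=
    TP.isLogConvexOfOrder_three (a := fun n => egfCoeff f (n + 1)) egf_tp
  have sheffer_tp := tp_sheffer_one hf0 hfφ hPF
  have signed_tp := sheffer_tp.signed_sheffer_of_inverse hf0 hg0 hgf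
  refine ⟨⟨exp_tp, exp_tp.isLogConvexOfOrder_three, expStar_tp,
      expStar_tp.isLogConvexOfOrder_three⟩,
    ⟨TP.isSM egf_tp, egf_logConvex⟩, ?_,
    ⟨sheffer_tp.logTriangle_of_sheffer hf0, sheffer_tp.fracTriangle_of_sheffer hf0, signed_tp,
      signed_tp.signed_logTriangle_of_sheffer hg0, signed_tp.signed_fracTriangle_of_sheffer hg0⟩,
    ⟨fun _ => convolutionPreservesSM_sheffer_expMul hf0 hfφ hPF,
      convolutionPreservesSM_sheffer_succ_succ hf0 hfφ hPF,
      convolutionPreservesSM_fracTriangle hf0 hfφ hPF⟩, fun m x hx => ?_⟩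
  · exact tp_sheffer_expMul (algebraMap_mem_coeffSubsemiring algebraMap_mem_nonneg) hf0 hfφ hPF
      X_mem_coeffSubsemiring
  · rw [hx] at hfφ
    exact ⟨hasBranchedFraction_shefferExp hf0 hfφ, hasBranchedFraction_shefferExpStar hf0 hfφ⟩
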